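/- An \emph{mm-space} is a complete separable metric space $(X,d)$ of diameter at most $1$ with a Borel probability measure $\mu$ of full support. Let $M_\infty$ be the compact space of infinite matrices $(d_{i,j})_{i,j\ge 1}$ with $0\le d_{i,j}\le 1$, $d_{i,j}=d_{j,i}$, $d_{i,i}=0$, with the topology of entrywise convergence, and let $\mathcal P(M_\infty)$ be the space of Borel probability measures on $M_\infty$ with the weak topology. The sampling measure $\tau(X)\in\mathcal P(M_\infty)$ of an mm-space $X$ is the law of $(d(x_i,x_j))_{i,j}$, where $x_1,x_2,\dots$ are independent $\mu$-random points. The sampling compactification $\overline\chi$ is the closure in $\mathcal P(M_\infty)$ of the set of the measures $\tau(X)$ of all mm-spaces $X$. A \emph{quantum metric measure space} (qmm-space) is a triple $(X,\mu,d^*)$, where $X$ is a standard Borel space, $\mu$ is a probability measure on $X$, and $d^*:X\times X\to\mathcal P[0,1]$ is a Borel measurable map into the space of probability measures on $[0,1]$ such that $d^*(x,x)=\delta_0$ and $d^*(x,y)=d^*(y,x)$ for all $x,y\in X$, and such that for $\mu^3$-almost every triple $(a,b,c)\in X^3$, independent random lengths $l(a,b)$, $l(b,c)$, $l(a,c)$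 with laws $d^*(a,b)$, $d^*(b,c)$, $d^*(a,c)$ almost surely satisfy the triangle inequalities (each is at most the sum of the other two). Its sampling measure $\tau(X)\in\mathcal P(M_\infty)$ is obtained as follows. A symmetric matrix $s=(s_{i,j})$ with entries in $\mathcal P[0,1]$ and $s_{i,i}=\delta_0$ defines the law on $M_\infty$ of the random symmetric matrix whose entries above the diagonal are independent, the $(i,j)$ entry having law $s_{i,j}$; then $\tau(X)$ is the barycenter (mixture) of the laws defined by $(d^*(x_i,x_j))_{i,j}$, where $x_1,x_2,\dots$ are independent $\mu$-random points. \textbf{Theorem.} For every $\kappa\in\overline\chi$ there is a qmm-space $X$ with $\tau(X)=\kappa$. Conversely, $\tau(X)\in\overline\chi$ for every qmm-space $X$. -/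

import Mathlib

open MeasureTheory Set Topology

universe u

/-- The space `M_∞` of infinite symmetric matrices with entries in `[0,1]` and zero diagonal, with
the topology of entrywise convergence (rows and columns are indexed by `0, 1, 2, …`). -/
abbrev MInfty : Type :=
  {d : ℕ → ℕ → unitInterval // (∀ i j, d i j = d j i) ∧ ∀ i, d i i = 0}

/-- A metric measure space: a complete separable metric space of diameter at most one with
a Borel probability measure of full support. Such a space has at most continuum many points, so
carriers in `Type` give all of them up to isomorphism. -/
structure MMSpace where
  carrier : Type
  [metric : MetricSpace carrier]
  [complete : CompleteSpace carrier]
  [separable : TopologicalSpace.SeparableSpace carrier]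
  [meas : MeasurableSpace carrier]
  [borel : BorelSpace carrier]
  dist_le_one : ∀ x y : carrier, dist x y ≤ 1
  μ : Measure carrier
  [prob : IsProbabilityMeasure μ]
  [fullSupport : μ.IsOpenPosMeasure]

namespace MMSpace

attribute [instance] metric complete separable meas borel prob fullSupport

/-- The map `ρ : X^ℕ → M_∞`, `(x_i) ↦ (d(x_i, x_j))`. -/
def rho (X : MMSpace) (x : ℕ → X.carrier) : MInfty :=
  ⟨fun i j => ⟨dist (x i) (x j), mem_Icc.2 ⟨dist_nonneg, X.dist_le_one _ _⟩⟩,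
    fun i j => Subtype.ext (dist_comm (x i) (x j)), fun i => Subtype.ext (dist_self (x i))⟩

theorem measurable_rho (X : MMSpace) : Measurable X.rho := by
  have : SecondCountableTopology X.carrier := UniformSpace.secondCountable_of_separable _
  refine Measurable.subtype_mk (measurable_pi_lambda _ fun i => measurable_pi_lambda _ fun j => ?_)
  exact Measurable.subtype_mk ((measurable_pi_apply i).dist (measurable_pi_apply j))

/-- The sampling measure `τ(X)`: the push-forward of `μ × μ × ⋯` by `ρ`. -/
noncomputable def tau (X : MMSpace) : ProbabilityMeasure MInfty :=
  ⟨(Measure.infinitePi fun _ : ℕ => X.μ).map X.rho,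
    Measure.isProbabilityMeasure_map X.measurable_rho.aemeasurable⟩

end MMSpace

/-- The sampling compactification of the set of mm-spaces: the closure of the set of their sampling
measures in the space of probability measures on `M_∞` with the weak topology. -/
def chiBar : Set (ProbabilityMeasure MInfty) :=
  closure (range MMSpace.tau)

/-- The point mass at `0`, as an element of `𝒫[0,1]`. -/
noncomputable def diracZero : ProbabilityMeasure unitInterval :=
  ⟨Measure.dirac 0, inferInstance⟩

/-- Quantum metric measure spaces. The `σ`-algebra on `𝒫[0,1]` is the one generated by the
evaluations at Borel sets, which is the Borel `σ`-algebra of the weak topology. -/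
structure QMMSpace where
  carrier : Type u
  [meas : MeasurableSpace carrier]
  [standardBorel : StandardBorelSpace carrier]
  μ : Measure carrier
  [prob : IsProbabilityMeasure μ]
  d : carrier → carrier → ProbabilityMeasure unitInterval
  measurable_d : Measurable (Function.uncurry d)
  d_self : ∀ x, d x x = diracZero
  d_comm : ∀ x y, d x y = d y x
  /-- For almost all triples `(a, b, c)`, independent lengths `l(a,b)`, `l(b,c)`, `l(a,c)` with laws
  `d a b`, `d b c`, `d a c` almost surely satisfy the triangle inequalities. -/
  triangle : ∀ᵐ t : carrier × carrier × carrier ∂(μ.prod (μ.prod μ)),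
    ∀ᵐ l : unitInterval × unitInterval × unitInterval
      ∂((d t.1 t.2.1 : Measure unitInterval).prod
        ((d t.2.1 t.2.2 : Measure unitInterval).prod (d t.1 t.2.2 : Measure unitInterval))),
      (l.1 : ℝ) ≤ l.2.1 + l.2.2 ∧ (l.2.1 : ℝ) ≤ l.1 + l.2.2 ∧ (l.2.2 : ℝ) ≤ l.1 + l.2.1

/-- The space `M̂_∞` of infinite symmetric matrices with entries in `𝒫[0,1]` and with the point mass
at zero on the diagonal. -/
abbrev MHatInfty : Type :=
  {s : ℕ → ℕ → ProbabilityMeasure unitInterval // (∀ i j, s i j = s j i) ∧ ∀ i, s i i = diracZero}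

/-- The positions above the diagonal. -/
abbrev UpperPair : Type := {p : ℕ × ℕ // p.1 < p.2}

/-- The symmetric matrix with zero diagonal that has the given entries above the diagonal. -/
def symmFill (e : UpperPair → unitInterval) : MInfty :=
  ⟨fun i j => if h : i < j then e ⟨(i, j), h⟩ else if h : j < i then e ⟨(j, i), h⟩ else 0, by
    intro i j
    rcases lt_trichotomy i j with h | h | h
    · simp [h, h.not_gt]
    · simp [h]
    · simp [h, h.not_gt], by
    intro i
    simp⟩

theorem measurable_symmFill : Measurable symmFill := by
  refine Measurable.subtype_mk (measurable_pi_lambda _ fun i => measurable_pi_lambda _ fun j => ?_)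
  by_cases h : i < j
  · simpa [h] using measurable_pi_apply (X := fun _ : UpperPair => unitInterval) ⟨(i, j), h⟩
  · by_cases h' : j < i
    · simpa [h, h'] using measurable_pi_apply (X := fun _ : UpperPair => unitInterval) ⟨(j, i), h'⟩
    · simp [h, h']

/-- The probability measure on `M_∞` defined by `s ∈ M̂_∞`: the law of the random symmetric matrix
whose entries above the diagonal are independent, the `(i,j)` entry having law `s i j`. -/
noncomputable def matrixLaw (s : MHatInfty) : ProbabilityMeasure MInfty :=
  ⟨(Measure.infinitePi fun p : UpperPair => (s.1 p.1.1 p.1.2 : Measure unitInterval)).map symmFill,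
    Measure.isProbabilityMeasure_map measurable_symmFill.aemeasurable⟩

theorem measurable_matrixLaw : Measurable matrixLaw := by
  refine Measurable.subtype_mk ((Measure.measurable_map _ measurable_symmFill).comp ?_)
  refine Measurable.measure_of_isPiSystem_of_isProbabilityMeasure
    (generateFrom_squareCylinders (α := fun _ : UpperPair => unitInterval)).symm
    (isPiSystem_squareCylinders (fun _ => MeasurableSpace.isPiSystem_measurableSet)
      (fun _ => mem_ofPred.2 MeasurableSet.univ)) ?_
  intro t ht
  obtain ⟨F, S, hS, rfl⟩ := ht
  have hS' : ∀ i, MeasurableSet (S i) := fun i => hS i (mem_univ i)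
  have h : ∀ s : MHatInfty,
      (Measure.infinitePi fun p : UpperPair => (s.1 p.1.1 p.1.2 : Measure unitInterval))
        ((F : Set UpperPair).pi S)
      = ∏ p ∈ F, (s.1 p.1.1 p.1.2 : Measure unitInterval) (S p) :=
    fun s => Measure.infinitePi_pi _ (fun i _ => hS' i)
  simp only [h]
  refine Finset.measurable_prod _ fun p _ => ?_
  exact (Measure.measurable_coe (hS' p)).comp (measurable_subtype_coe.comp
    ((measurable_pi_apply p.1.2).comp ((measurable_pi_apply p.1.1).comp measurable_subtype_coe)))

/-- The barycenter of a probability measure `P` on the space of probability measures on `Ω`: the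
mixture `A ↦ ∫ m(A) dP(m)`. -/
noncomputable def barycenter {Ω : Type*} [MeasurableSpace Ω]
    (P : ProbabilityMeasure (ProbabilityMeasure Ω)) : ProbabilityMeasure Ω :=
  ⟨(P : Measure (ProbabilityMeasure Ω)).bind fun m => (m : Measure Ω), by
    constructor
    have h : Measurable fun m : ProbabilityMeasure Ω => (m : Measure Ω) := measurable_subtype_coe
    rw [Measure.bind_apply MeasurableSet.univ h.aemeasurable]
    simp⟩

namespace QMMSpace

attribute [instance] meas standardBorel prob

/-- The map `X^ℕ → M̂_∞`, `(x_i) ↦ (d^*(x_i, x_j))`. -/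
def rhoHat (X : QMMSpace.{u}) (x : ℕ → X.carrier) : MHatInfty :=
  ⟨fun i j => X.d (x i) (x j), fun _ _ => X.d_comm _ _, fun _ => X.d_self _⟩

theorem measurable_rhoHat (X : QMMSpace.{u}) : Measurable X.rhoHat := by
  refine Measurable.subtype_mk (measurable_pi_lambda _ fun i => measurable_pi_lambda _ fun j => ?_)
  exact X.measurable_d.comp
    ((measurable_pi_apply (X := fun _ : ℕ => X.carrier) i).prodMk (measurable_pi_apply j))

/-- The sampling measure `τ(X)`: push `μ × μ × ⋯` forward to `M̂_∞`, view it as a probability measure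
on the space of probability measures on `M_∞`, and take its barycenter. -/
noncomputable def tau (X : QMMSpace.{u}) : ProbabilityMeasure MInfty :=
  barycenter ⟨((Measure.infinitePi fun _ : ℕ => X.μ).map X.rhoHat).map matrixLaw, by
    have := Measure.isProbabilityMeasure_map
      (μ := Measure.infinitePi fun _ : ℕ => X.μ) X.measurable_rhoHat.aemeasurable
    exact Measure.isProbabilityMeasure_map measurable_matrixLaw.aemeasurable⟩

end QMMSpace

/-!
Sampling measures of mm-spaces are laws of exchangeable and dissociated random semimetrics, where
dissociated means that the distances inside disjoint sets of indices are independent. These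
properties survive weak limits, so every element of `chiBar` has them. Sampling measures of
qmm-spaces have them too: the triangle inequalities hold almost surely between three random points.

Every law `κ` with these properties is a limit of sampling measures of mm-spaces. Independent points
with diffuse real labels are compared through a `κ`-random semimetric on the cells of a fine
partition of the line. By dissociation the variance of the resulting sample averages vanishes in the
limit, so semimetrics whose sample averages are close to the averages under `κ` exist.

Every such `κ` is also the sampling measure of a qmm-space. Split the indices into sample points and
two kinds of reference points. Given the distances between reference points, exchangeability makes
the rows of distances from the sample points to the reference points of the first kind independent
and identically distributed, and makes the lengths between sample points conditionally independent,
each with a law that depends only on the rows of its two endpoints. By dissociation the reference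
points are independent of the sample, so almost every fixed family of reference points serves: rows
are the points of the qmm-space, and these laws are its `d^*`.
-/

open ProbabilityTheory Filter

open scoped BoundedContinuousFunction ENNReal

section InfiniteProducts

variable {ι ι₁ ι₂ X : Type*} [MeasurableSpace X]

theorem infinitePi_map_sumElim (μ : ι₁ ⊕ ι₂ → Measure X) [∀ i, IsProbabilityMeasure (μ i)] :
    (Measure.infinitePi μ).map (fun x => (fun i => x (Sum.inl i), fun i => x (Sum.inr i)))
      = (Measure.infinitePi fun i => μ (Sum.inl i)).prod
          (Measure.infinitePi fun i => μ (Sum.inr i)) := by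
  let merge : (ι₁ → X) × (ι₂ → X) → ι₁ ⊕ ι₂ → X := fun p => Sum.elim p.1 p.2
  have hmerge : Measurable merge := measurable_pi_lambda _ fun i => by
    rcases i with i | i <;> dsimp only [merge, Sum.elim_inl, Sum.elim_inr] <;> fun_prop
  suffices h : ((Measure.infinitePi fun i => μ (Sum.inl i)).prod
      (Measure.infinitePi fun i => μ (Sum.inr i))).map merge = Measure.infinitePi μ by
    rw [← h, Measure.map_map (by fun_prop) hmerge]
    exact Measure.map_id
  refine Measure.eq_infinitePi μ fun s t ht => ?_
  have hpre : merge ⁻¹' ((s : Set (ι₁ ⊕ ι₂)).pi t)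
      = ((s.toLeft : Set ι₁).pi fun i => t (Sum.inl i)) ×ˢ
        ((s.toRight : Set ι₂).pi fun i => t (Sum.inr i)) := by
    ext p
    simp [merge, Set.mem_pi]
  rw [Measure.map_apply hmerge (.pi s.countable_toSet fun i _ => ht i), hpre, Measure.prod_prod,
    Measure.infinitePi_pi _ (fun i _ => ht _), Measure.infinitePi_pi _ (fun i _ => ht _)]
  conv_rhs => rw [← s.toLeft_disjSum_toRight, Finset.prod_disjSum]

theorem infinitePi_map_pair_of_injective (μ : ι → Measure X) [∀ i, IsProbabilityMeasure (μ i)]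
    {σ : ι₁ → ι} {τ : ι₂ → ι} (hσ : Function.Injective σ) (hτ : Function.Injective τ)
    (hστ : ∀ i j, σ i ≠ τ j) :
    (Measure.infinitePi μ).map (fun x => (fun i => x (σ i), fun i => x (τ i)))
      = (Measure.infinitePi fun i => μ (σ i)).prod (Measure.infinitePi fun i => μ (τ i)) := by
  have h := infinitePi_map_sumElim fun i => μ (Sum.elim σ τ i)
  rwa [← Measure.map_infinitePi_infinitePi_of_inj (P := μ) (hσ.sumElim hτ hστ),
    Measure.map_map (by fun_prop) (by fun_prop)] at h

theorem infinitePi_map_eval_triple (μ : ι → Measure X) [∀ i, IsProbabilityMeasure (μ i)]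
    {i j k : ι} (hij : i ≠ j) (hik : i ≠ k) (hjk : j ≠ k) :
    (Measure.infinitePi μ).map (fun x => (x i, x j, x k))
      = (μ i).prod ((μ j).prod (μ k)) := by
  have hindep : IndepFun (fun x : ι → X => x i) (fun x : ι → X => (x j, x k))
      (Measure.infinitePi μ) :=
    ((iIndepFun_infinitePi (P := μ) (X := fun _ x => x) fun _ => measurable_id).indepFun_prodMk
      (fun i => measurable_pi_apply i) j k i hij.symm hik.symm).symm
  rw [(indepFun_iff_map_prod_eq_prod_map_map (measurable_pi_apply i).aemeasurable
    (measurable_pi_apply j |>.prodMk (measurable_pi_apply k)).aemeasurable).1 hindep,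
    Measure.infinitePi_map_eval_prod hjk, Measure.infinitePi_map_eval]

theorem ae_injective_infinitePi [MeasurableEq X] (μ : Measure X) [IsProbabilityMeasure μ]
    [NullSingletonClass μ] [Countable ι] :
    ∀ᵐ x ∂(Measure.infinitePi fun _ : ι => μ), Function.Injective x := by
  have hdiag : ∀ᵐ p ∂μ.prod μ, p.1 ≠ p.2 := by
    rw [Measure.ae_prod_iff_ae_ae (p := fun p : X × X => p.1 ≠ p.2)
      (measurableSet_eq_fun measurable_fst measurable_snd).compl]
    refine .of_forall fun x => ?_
    filter_upwards [compl_mem_ae_iff.2 (measure_singleton (μ := μ) x)] with y hy using Ne.symm hy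
  have hne (i j : ι) : ∀ᵐ x ∂(Measure.infinitePi fun _ : ι => μ), x i = x j → i = j := by
    rcases eq_or_ne i j with hij | hij
    · exact .of_forall fun _ _ => hij
    rw [← Measure.infinitePi_map_eval_prod (P := fun _ : ι => μ) hij] at hdiag
    filter_upwards [ae_of_ae_map (by fun_prop) hdiag] with x hx h using absurd h hx
  filter_upwards [ae_all_iff.2 fun i => ae_all_iff.2 (hne i)] with x hx i j using hx i j

end InfiniteProducts

section Bind

variable {α β γ : Type*} [MeasurableSpace α] [MeasurableSpace β] [MeasurableSpace γ]

theorem map_measure_bind (μ : Measure α) {k : α → Measure β} (hk : Measurable k) {g : β → γ}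
    (hg : Measurable g) : (μ.bind k).map g = μ.bind fun a => (k a).map g := by
  rw [← Measure.bind_dirac_eq_map _ hg, Measure.bind_bind (g := fun b => Measure.dirac (g b))
    hk.aemeasurable (Measure.measurable_dirac.comp hg).aemeasurable]
  exact Measure.bind_congr_right (.of_forall fun a => Measure.bind_dirac_eq_map _ hg)

theorem bind_measure_map (μ : Measure α) {f : α → β} (hf : Measurable f) {k : β → Measure γ}
    (hk : Measurable k) : (μ.map f).bind k = μ.bind fun a => k (f a) := by
  rw [← Measure.bind_dirac_eq_map _ hf, Measure.bind_bind (f := fun a => Measure.dirac (f a))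
    (Measure.measurable_dirac.comp hf).aemeasurable hk.aemeasurable]
  exact Measure.bind_congr_right (.of_forall fun a => Measure.dirac_bind hk (f a))

theorem prod_bind_prod (μ : Measure α) (ν : Measure β) [IsProbabilityMeasure μ]
    [IsProbabilityMeasure ν] {δ : Type*} [MeasurableSpace δ] {k : α → ProbabilityMeasure γ}
    (hk : Measurable k) {l : β → ProbabilityMeasure δ} (hl : Measurable l) :
    (μ.prod ν).bind (fun p => (k p.1 : Measure γ).prod (l p.2 : Measure δ))
      = (μ.bind fun a => (k a : Measure γ)).prod (ν.bind fun b => (l b : Measure δ)) := by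
  have hkl : Measurable fun p : α × β => (k p.1 : Measure γ).prod (l p.2 : Measure δ) :=
    ProbabilityMeasure.measurable_fun_prod.comp
      ((hk.comp measurable_fst).prodMk (hl.comp measurable_snd))
  have hk : Measurable fun a => (k a : Measure γ) := measurable_subtype_coe.comp hk
  have hl : Measurable fun b => (l b : Measure δ) := measurable_subtype_coe.comp hl
  have := isProbabilityMeasure_bind hkl.aemeasurable (.of_forall fun _ => inferInstance)
    (m := μ.prod ν)
  have := isProbabilityMeasure_bind hk.aemeasurable (.of_forall fun _ => inferInstance) (m := μ)
  have := isProbabilityMeasure_bind hl.aemeasurable (.of_forall fun _ => inferInstance) (m := ν)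
  refine Measure.ext_prod fun {A B} hA hB => ?_
  rw [Measure.prod_prod, Measure.bind_apply (hA.prod hB) hkl.aemeasurable,
    Measure.bind_apply hA hk.aemeasurable, Measure.bind_apply hB hl.aemeasurable]
  simp only [Measure.prod_prod]
  exact lintegral_prod_mul ((Measure.measurable_coe hA).comp hk).aemeasurable
    ((Measure.measurable_coe hB).comp hl).aemeasurable

theorem snd_compProd_eq_bind (k : Kernel α β) [IsSFiniteKernel k] (l : Kernel (α × β) γ)
    [IsSFiniteKernel l] (a : α) : (k ⊗ₖ l).snd a = (k a).bind fun b => l (a, b) := by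
  ext S hS
  have hl : Measurable fun b => l (a, b) := l.measurable.comp measurable_prodMk_left
  rw [Kernel.snd_apply' _ _ hS, Kernel.compProd_apply (measurable_snd hS),
    Measure.bind_apply hS hl.aemeasurable]
  rfl

end Bind

section InfinitePiKernel

variable {α ι : Type*} [MeasurableSpace α] {X : ι → Type*} [∀ i, MeasurableSpace (X i)]

theorem measurable_infinitePi {k : ∀ i, α → Measure (X i)} [∀ i a, IsProbabilityMeasure (k i a)]
    (hk : ∀ i, Measurable (k i)) : Measurable fun a => Measure.infinitePi fun i => k i a := by
  refine Measurable.measure_of_isPiSystem_of_isProbabilityMeasure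
    (generateFrom_squareCylinders (α := X)).symm
    (isPiSystem_squareCylinders (fun _ => MeasurableSpace.isPiSystem_measurableSet)
      (fun _ => MeasurableSet.univ)) ?_
  rintro _ ⟨F, S, hS, rfl⟩
  have hS (i : ι) : MeasurableSet (S i) := hS i (mem_univ i)
  simp only [fun a => Measure.infinitePi_pi (fun i => k i a) (s := F) (t := S) fun i _ => hS i]
  exact Finset.measurable_prod _ fun i _ => (Measure.measurable_coe (hS i)).comp (hk i)

/-- The kernel of conditionally independent families: given `a`, the `i`-th coordinate has law
`k i a`. -/
noncomputable def infinitePiKernel (k : ∀ i, Kernel α (X i)) [∀ i, IsMarkovKernel (k i)] :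
    Kernel α (∀ i, X i) where
  toFun a := Measure.infinitePi fun i => k i a
  measurable' := measurable_infinitePi fun i => (k i).measurable

theorem infinitePiKernel_apply (k : ∀ i, Kernel α (X i)) [∀ i, IsMarkovKernel (k i)] (a : α) :
    infinitePiKernel k a = Measure.infinitePi fun i => k i a := rfl

instance (k : ∀ i, Kernel α (X i)) [∀ i, IsMarkovKernel (k i)] :
    IsMarkovKernel (infinitePiKernel k) :=
  ⟨fun a => by rw [infinitePiKernel_apply]; infer_instance⟩

end InfinitePiKernel

section ConditionalLaw

variable {Ω V V₀ Y : Type*} [MeasurableSpace Ω] [MeasurableSpace V] [MeasurableSpace V₀]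
  [MeasurableSpace Y] {P : Measure Ω} {η : Ω → V} {ξ : Ω → Y}

-- On finite values, `f ^ 2 + g ^ 2 = 2 * f * g + (f - g) ^ 2`.
theorem ae_eq_of_lintegral_mul_self_eq {f g : Ω → ℝ≥0∞} (hf : Measurable f)
    (hg : Measurable g) (hfin : ∫⁻ ω, f ω * f ω ∂P ≠ ∞)
    (hgg : ∫⁻ ω, g ω * g ω ∂P = ∫⁻ ω, f ω * f ω ∂P)
    (hfg : ∫⁻ ω, f ω * g ω ∂P = ∫⁻ ω, f ω * f ω ∂P) : f =ᵐ[P] g := by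
  have hpoint (a b : ℝ≥0∞) :
      a * a + b * b = 2 * (a * b) + ((a - b) * (a - b) + (b - a) * (b - a)) := by
    rcases eq_or_ne a ∞ with rfl | ha <;> rcases eq_or_ne b ∞ with rfl | hb
    · simp
    · simp [hb]
    · simp [ha]
    rcases le_total a b with h | h <;> obtain ⟨c, rfl⟩ := exists_add_of_le h
    · rw [tsub_eq_zero_of_le h, ENNReal.add_sub_cancel_left ha]
      ring
    · rw [tsub_eq_zero_of_le h, ENNReal.add_sub_cancel_left hb]
      ring
  have hdiff : ∫⁻ ω, ((f ω - g ω) * (f ω - g ω) + (g ω - f ω) * (g ω - f ω)) ∂P = 0 := by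
    have h := lintegral_congr (μ := P) fun ω => hpoint (f ω) (g ω)
    rw [lintegral_add_left (by fun_prop), lintegral_add_left (by fun_prop),
      lintegral_const_mul _ (by fun_prop), hgg, hfg, ← two_mul] at h
    exact (ENNReal.add_right_inj (by finiteness)).1 (h.symm.trans (add_zero _).symm)
  filter_upwards [(lintegral_eq_zero_iff (by fun_prop)).1 hdiff] with ω hω
  simp only [Pi.zero_apply, add_eq_zero, mul_self_eq_zero, tsub_eq_zero_iff_le] at hω
  exact le_antisymm hω.1 hω.2

theorem hasCondDistrib_comp_measurePreserving {k : Kernel V Y}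
    (hη : Measurable η) (hξ : Measurable ξ) (h : HasCondDistrib ξ η k P) {T : Ω → Ω}
    (hT : MeasurePreserving T P P) : HasCondDistrib (ξ ∘ T) (η ∘ T) k P := by
  refine ⟨(hη.comp hT.measurable).prodMk (hξ.comp hT.measurable) |>.aemeasurable, ?_⟩
  have hη' : P.map (η ∘ T) = P.map η := by rw [← Measure.map_map hη hT.measurable, hT.map_eq]
  rw [hη', ← h.map_eq]
  conv_rhs => rw [← hT.map_eq, Measure.map_map (hη.prodMk hξ) hT.measurable]
  rfl

variable [IsProbabilityMeasure P]

theorem hasCondDistrib_condDistrib [StandardBorelSpace Y] [Nonempty Y] (hη : Measurable η)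
    (hξ : Measurable ξ) : HasCondDistrib ξ η (condDistrib ξ η P) P :=
  ⟨by fun_prop, (compProd_map_condDistrib hξ.aemeasurable).symm⟩

theorem lintegral_mul_kernel_of_hasCondDistrib {k : Kernel V Y} [IsMarkovKernel k]
    (h : HasCondDistrib ξ η k P) {w : V → ℝ≥0∞} (hw : Measurable w) {S : Set Y}
    (hS : MeasurableSet S) :
    ∫⁻ v, w v * k v S ∂P.map η = ∫⁻ ω, w (η ω) * S.indicator 1 (ξ ω) ∂P := by
  have hind : Measurable (S.indicator (1 : Y → ℝ≥0∞)) := measurable_one.indicator hS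
  calc ∫⁻ v, w v * k v S ∂P.map η
      = ∫⁻ v, ∫⁻ y, w v * S.indicator 1 y ∂(k v) ∂P.map η := by
        simp only [lintegral_const_mul _ hind, lintegral_indicator_one hS]
    _ = ∫⁻ p, w p.1 * S.indicator 1 p.2 ∂(P.map η ⊗ₘ k) := by
        rw [Measure.lintegral_compProd (by fun_prop)]
    _ = ∫⁻ ω, w (η ω) * S.indicator 1 (ξ ω) ∂P :=
        (h.lintegral_comp (f := fun p => w p.1 * S.indicator 1 p.2) (by fun_prop)).symm

-- Conditioning is a contraction of `L²`: under the law of `η`, the functions `v ↦ k (f v) S` and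
-- `v ↦ k v S` have the same norm, and their inner product is the square of that norm.
theorem hasCondDistrib_comap_of_map_eq (hη : Measurable η) (hξ : Measurable ξ) {k : Kernel V Y}
    [IsMarkovKernel k] (h : HasCondDistrib ξ η k P) {f : V → V} (hf : Measurable f)
    (hlaw : P.map (fun ω => (f (η ω), ξ ω)) = P.map (fun ω => (η ω, ξ ω))) :
    HasCondDistrib ξ η (k.comap f hf) P := by
  have := Measure.isProbabilityMeasure_map (μ := P) hη.aemeasurable
  refine ⟨by fun_prop, h.map_eq.trans (Measure.ext_prod fun {A S} hA hS => ?_)⟩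
  have hkS : Measurable fun v => k v S := k.measurable_coe hS
  have hmap : (P.map η).map f = P.map η := by
    have := congrArg Measure.fst hlaw
    rwa [Measure.fst_map_prodMk hξ, Measure.fst_map_prodMk hξ, ← Function.comp_def f,
      ← Measure.map_map hf hη] at this
  have hcross : ∫⁻ v, k v S * k (f v) S ∂P.map η = ∫⁻ v, k v S * k v S ∂P.map η := by
    simp only [mul_comm (k _ S) (k (f _) S)]
    rw [lintegral_mul_kernel_of_hasCondDistrib h hkS hS,
      lintegral_mul_kernel_of_hasCondDistrib h (w := fun v => k (f v) S) (hkS.comp hf) hS]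
    have := congrArg (fun μ => ∫⁻ p, k p.1 S * S.indicator 1 p.2 ∂μ) hlaw
    rwa [lintegral_map (by fun_prop) (by fun_prop), lintegral_map (by fun_prop) (by fun_prop)]
      at this
  have hnorm : ∫⁻ v, k (f v) S * k (f v) S ∂P.map η = ∫⁻ v, k v S * k v S ∂P.map η := by
    rw [← lintegral_map (f := fun v => k v S * k v S) (by fun_prop) hf, hmap]
  have hfin : ∫⁻ v, k v S * k v S ∂P.map η ≠ ∞ :=
    ((lintegral_mono fun v => mul_le_one' (prob_le_one (μ := k v) (s := S))
      (prob_le_one (μ := k v) (s := S))).trans_lt (by simp)).ne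
  rw [Measure.compProd_apply_prod hA hS, Measure.compProd_apply_prod hA hS]
  exact lintegral_congr_ae (ae_restrict_of_ae
    (ae_eq_of_lintegral_mul_self_eq hkS (hkS.comp hf) hfin hnorm hcross))

-- Replacing `η` by `η ∘ T` shows that `(g (p η), ξ)` and `(η, ξ)` have the same law, so knowing all
-- of `η` tells no more about `ξ` than knowing `p η`.
theorem hasCondDistrib_comap_of_measurePreserving [StandardBorelSpace Y] [Nonempty Y]
    (hη : Measurable η) (hξ : Measurable ξ) {p : V → V₀} (hp : Measurable p) {k : Kernel V₀ Y}
    [IsMarkovKernel k] (h : HasCondDistrib ξ (p ∘ η) k P) {T : Ω → Ω}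
    (hT : MeasurePreserving T P P) {g : V₀ → V} (hg : Measurable g)
    (hηT : ∀ ω, η (T ω) = g (p (η ω))) (hξT : ∀ ω, ξ (T ω) = ξ ω) :
    HasCondDistrib ξ η (k.comap p hp) P := by
  have := Measure.isProbabilityMeasure_map (μ := P) hη.aemeasurable
  have := Measure.isProbabilityMeasure_map (μ := P) (hp.comp hη).aemeasurable
  have hlaw : P.map (fun ω => ((g ∘ p) (η ω), ξ ω)) = P.map (fun ω => (η ω, ξ ω)) := by
    conv_rhs => rw [← hT.map_eq, Measure.map_map (by fun_prop) hT.measurable]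
    simp only [Function.comp_def, hηT, hξT]
  have hcomap : HasCondDistrib ξ η (((condDistrib ξ η P).comap g hg).comap p hp) P :=
    hasCondDistrib_comap_of_map_eq hη hξ (hasCondDistrib_condDistrib hη hξ) (hg.comp hp) hlaw
  have hae : (condDistrib ξ η P).comap g hg =ᵐ[P.map (p ∘ η)] k :=
    Kernel.ae_eq_of_compProd_eq (hcomap.comp_right.map_eq.symm.trans h.map_eq)
  rw [← Measure.map_map hp hη] at hae
  exact ⟨by fun_prop, hcomap.map_eq.trans
    (Measure.compProd_congr (ae_of_ae_map hp.aemeasurable hae))⟩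

theorem ext_prod_pi {ι : Type*} {μ ν : Measure (V × (ι → Y))} [IsFiniteMeasure μ]
    (h : ∀ (A : Set V) (F : Finset ι) (S : ι → Set Y), MeasurableSet A →
      (∀ i, MeasurableSet (S i)) → μ (A ×ˢ (F : Set ι).pi S) = ν (A ×ˢ (F : Set ι).pi S)) :
    μ = ν := by
  refine Measure.ext_prod fun {A B} hA hB => ?_
  have hslice (μ : Measure (V × (ι → Y))) {B : Set (ι → Y)} (hB : MeasurableSet B) :
      μ (A ×ˢ B) = (μ.restrict (A ×ˢ univ)).snd B := by
    rw [Measure.snd_apply hB, Measure.restrict_apply (measurable_snd hB)]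
    congr 1
    ext p
    simp [and_comm]
  rw [hslice μ hB, hslice ν hB]
  congr 1
  refine ext_of_generate_finite _ (generateFrom_squareCylinders (α := fun _ : ι => Y)).symm
    (isPiSystem_squareCylinders (fun _ => MeasurableSpace.isPiSystem_measurableSet)
      (fun _ => MeasurableSet.univ)) ?_ ?_
  · rintro _ ⟨F, S, hS, rfl⟩
    have hS (i : ι) : MeasurableSet (S i) := hS i (mem_univ i)
    have hpi : MeasurableSet ((F : Set ι).pi S) := .pi F.countable_toSet fun i _ => hS i
    rw [← hslice μ hpi, ← hslice ν hpi, h A F S hA hS]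
  · rw [← hslice μ .univ, ← hslice ν .univ]
    simpa using h A ∅ (fun _ => univ) hA fun _ => .univ

variable {ι : Type*} {Z : Ω → V} {Y' : ι → Ω → Y} {k : ι → Kernel V Y} [∀ i, IsMarkovKernel (k i)]

theorem lintegral_mul_prod_kernel_of_hasCondDistrib (hZ : Measurable Z)
    (hY : ∀ i, Measurable (Y' i))
    (h : ∀ i, HasCondDistrib (Y' i) (fun ω => (Z ω, fun j : {j : ι // j ≠ i} => Y' j ω))
      ((k i).prodMkRight ({j : ι // j ≠ i} → Y)) P)
    (F : Finset ι) {S : ι → Set Y} (hS : ∀ i, MeasurableSet (S i)) {w : V → ℝ≥0∞}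
    (hw : Measurable w) :
    ∫⁻ ω, w (Z ω) * ∏ i ∈ F, (S i).indicator 1 (Y' i ω) ∂P
      = ∫⁻ ω, w (Z ω) * ∏ i ∈ F, k i (Z ω) (S i) ∂P := by
  classical
  have hind (i : ι) : Measurable ((S i).indicator (1 : Y → ℝ≥0∞)) :=
    measurable_one.indicator (hS i)
  have hkS (i : ι) : Measurable fun v => k i v (S i) := (k i).measurable_coe (hS i)
  induction F using Finset.induction_on generalizing w with
  | empty => simp
  | insert i F hi ih =>
    let w' : V × ({j : ι // j ≠ i} → Y) → ℝ≥0∞ := fun v =>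
      w v.1 * ∏ j ∈ F.subtype (· ≠ i), (S j).indicator 1 (v.2 j)
    have hw' : Measurable w' := by fun_prop
    have hw'_apply (ω : Ω) : w' (Z ω, fun j => Y' j ω)
        = w (Z ω) * ∏ j ∈ F, (S j).indicator 1 (Y' j ω) := by
      have hF : F.filter (· ≠ i) = F :=
        Finset.filter_true_of_mem fun j hj => ne_of_mem_of_not_mem hj hi
      simp only [w']
      rw [Finset.prod_subtype_eq_prod_filter (fun j => (S j).indicator (1 : Y → ℝ≥0∞) (Y' j ω)), hF]
    calc ∫⁻ ω, w (Z ω) * ∏ j ∈ insert i F, (S j).indicator 1 (Y' j ω) ∂P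
        = ∫⁻ ω, w' (Z ω, fun j => Y' j ω) * (S i).indicator 1 (Y' i ω) ∂P := by
          simp only [Finset.prod_insert hi, hw'_apply]
          exact lintegral_congr fun ω => by ring
      _ = ∫⁻ ω, w' (Z ω, fun j => Y' j ω) * k i (Z ω) (S i) ∂P := by
          rw [← lintegral_mul_kernel_of_hasCondDistrib (h i) hw' (hS i)]
          exact lintegral_map (hw'.mul ((hkS i).comp measurable_fst)) (by fun_prop)
      _ = ∫⁻ ω, (w (Z ω) * k i (Z ω) (S i)) * ∏ j ∈ F, (S j).indicator 1 (Y' j ω) ∂P := by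
          simp only [hw'_apply]
          exact lintegral_congr fun ω => by ring
      _ = ∫⁻ ω, (w (Z ω) * k i (Z ω) (S i)) * ∏ j ∈ F, k j (Z ω) (S j) ∂P :=
          ih (w := fun v => w v * k i v (S i)) (hw.mul (hkS i))
      _ = ∫⁻ ω, w (Z ω) * ∏ j ∈ insert i F, k j (Z ω) (S j) ∂P := by
          simp only [Finset.prod_insert hi, mul_assoc]

theorem hasCondDistrib_infinitePiKernel [Countable ι] (hZ : Measurable Z)
    (hY : ∀ i, Measurable (Y' i))
    (h : ∀ i, HasCondDistrib (Y' i) (fun ω => (Z ω, fun j : {j : ι // j ≠ i} => Y' j ω))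
      ((k i).prodMkRight ({j : ι // j ≠ i} → Y)) P) :
    HasCondDistrib (fun ω i => Y' i ω) Z (infinitePiKernel k) P := by
  have := Measure.isProbabilityMeasure_map (μ := P) hZ.aemeasurable
  have hYm : Measurable fun ω i => Y' i ω := measurable_pi_lambda _ hY
  refine ⟨by fun_prop, ext_prod_pi fun A F S hA hS => ?_⟩
  have hpi : MeasurableSet ((F : Set ι).pi S) := .pi F.countable_toSet fun i _ => hS i
  have hind : Measurable (A.indicator (1 : V → ℝ≥0∞)) := measurable_one.indicator hA
  have hkS : Measurable fun v => ∏ i ∈ F, k i v (S i) :=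
    Finset.measurable_prod _ fun i _ => (k i).measurable_coe (hS i)
  have hbox (ω : Ω) : (A ×ˢ (F : Set ι).pi S).indicator (1 : V × (ι → Y) → ℝ≥0∞)
      (Z ω, fun i => Y' i ω) = A.indicator 1 (Z ω) * ∏ i ∈ F, (S i).indicator 1 (Y' i ω) := by
    by_cases hA : Z ω ∈ A
    · by_cases hS : ∀ i ∈ F, Y' i ω ∈ S i
      · simp +contextual [hA, hS, Finset.prod_eq_one, Set.mem_pi]
      · obtain ⟨i, hi, hiS⟩ := not_forall₂.1 hS
        simp [hA, Set.mem_pi, hS, Finset.prod_eq_zero hi, hiS]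
    · simp [hA]
  calc P.map (fun ω => (Z ω, fun i => Y' i ω)) (A ×ˢ (F : Set ι).pi S)
      = ∫⁻ ω, A.indicator 1 (Z ω) * ∏ i ∈ F, (S i).indicator 1 (Y' i ω) ∂P := by
        rw [← lintegral_indicator_one (hA.prod hpi), lintegral_map
          (measurable_one.indicator (hA.prod hpi)) (hZ.prodMk hYm)]
        exact lintegral_congr hbox
    _ = ∫⁻ ω, A.indicator 1 (Z ω) * ∏ i ∈ F, k i (Z ω) (S i) ∂P :=
        lintegral_mul_prod_kernel_of_hasCondDistrib hZ hY h F hS hind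
    _ = ∫⁻ v in A, ∏ i ∈ F, k i v (S i) ∂P.map Z := by
        rw [← lintegral_indicator hA, lintegral_map (hkS.indicator hA) hZ]
        refine lintegral_congr fun ω => ?_
        by_cases hω : Z ω ∈ A <;> simp [hω]
    _ = (P.map Z ⊗ₘ infinitePiKernel k) (A ×ˢ (F : Set ι).pi S) := by
        rw [Measure.compProd_apply_prod hA hpi]
        simp only [infinitePiKernel_apply, Measure.infinitePi_pi _ fun i _ => hS i]

-- Rerandomizing everything except `f i (Z)` and `Y' i` by `T` shows that `Y' i` depends on the rest
-- through `f i (Z)` only.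
theorem hasCondDistrib_infinitePiKernel_comap_of_measurePreserving [Countable ι]
    [StandardBorelSpace Y] [Nonempty Y] {V₀ : ι → Type*} [∀ i, MeasurableSpace (V₀ i)]
    (hZ : Measurable Z) (hY : ∀ i, Measurable (Y' i)) {f : ∀ i, V → V₀ i}
    (hf : ∀ i, Measurable (f i)) {q : ∀ i, Kernel (V₀ i) Y} [∀ i, IsMarkovKernel (q i)]
    (h : ∀ i, HasCondDistrib (Y' i) (f i ∘ Z) (q i) P)
    {T : ι → Ω → Ω} (hT : ∀ i, MeasurePreserving (T i) P P)
    (hYT : ∀ i ω, Y' i (T i ω) = Y' i ω)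
    (hrest : ∀ i, ∃ g : V₀ i → V × ({j : ι // j ≠ i} → Y), Measurable g ∧
      ∀ ω, (Z (T i ω), fun j : {j : ι // j ≠ i} => Y' j (T i ω)) = g (f i (Z ω))) :
    HasCondDistrib (fun ω i => Y' i ω) Z
      (infinitePiKernel fun i => (q i).comap (f i) (hf i)) P := by
  refine hasCondDistrib_infinitePiKernel hZ hY fun i => ?_
  obtain ⟨g, hg, hgT⟩ := hrest i
  exact hasCondDistrib_comap_of_measurePreserving (p := f i ∘ Prod.fst) (by fun_prop) (hY i)
    ((hf i).comp measurable_fst) (h i) (hT i) hg hgT (hYT i)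

theorem hasCondDistrib_prodMk {W : Type*} [MeasurableSpace W] {ζ : Ω → W} {κ : Kernel V Y}
    {θ : Kernel (V × Y) W} (hη : Measurable η) (hξ : Measurable ξ) (hζ : Measurable ζ)
    (h : HasCondDistrib ξ η κ P) (h' : HasCondDistrib ζ (fun ω => (η ω, ξ ω)) θ P) :
    HasCondDistrib (fun ω => (ξ ω, ζ ω)) η (κ ⊗ₖ θ) P := by
  have := Measure.isProbabilityMeasure_map (μ := P) hη.aemeasurable
  refine ⟨by fun_prop, ?_⟩
  rw [← Measure.compProd_assoc', ← h.map_eq, ← h'.map_eq,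
    Measure.map_map (by fun_prop) (by fun_prop)]
  rfl

theorem exists_symmetric_hasCondDistrib [StandardBorelSpace Y] [Nonempty Y] (hη : Measurable η)
    (hξ : Measurable ξ) {s : V → V} (hs : Measurable s) (hss : Function.Involutive s)
    (hlaw : P.map (fun ω => (s (η ω), ξ ω)) = P.map (fun ω => (η ω, ξ ω))) :
    ∃ k : Kernel V Y, ∃ _ : IsMarkovKernel k, (∀ v, k (s v) = k v) ∧ HasCondDistrib ξ η k P := by
  have := Measure.isProbabilityMeasure_map (μ := P) hη.aemeasurable
  let k := condDistrib ξ η P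
  have hk : HasCondDistrib ξ η k P := hasCondDistrib_condDistrib hη hξ
  have hks : HasCondDistrib ξ η (k.comap s hs) P := hasCondDistrib_comap_of_map_eq hη hξ hk hs hlaw
  let avg : Kernel V Y :=
    { toFun := fun v => (2⁻¹ : ℝ≥0∞) • (k v + k (s v))
      measurable' := Measure.measurable_of_measurable_coe _ fun S hS =>
        ((k.measurable_coe hS).add ((k.measurable_coe hS).comp hs)).const_mul _ }
  have havg (v : V) : avg v = (2⁻¹ : ℝ≥0∞) • (k v + k (s v)) := rfl
  have hprob : IsMarkovKernel avg := ⟨fun v => ⟨by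
    rw [havg, Measure.smul_apply, Measure.add_apply, measure_univ, measure_univ, smul_eq_mul,
      one_add_one_eq_two, ENNReal.inv_mul_cancel two_ne_zero ENNReal.ofNat_ne_top]⟩⟩
  refine ⟨avg, hprob, fun v => by rw [havg, havg, hss, add_comm], by fun_prop, ?_⟩
  have hae : avg =ᵐ[P.map η] k := by
    filter_upwards [Kernel.ae_eq_of_compProd_eq (hks.map_eq.symm.trans hk.map_eq)] with v hv
    rw [havg, ← Kernel.comap_apply k hs, hv, ← two_smul ℝ≥0∞, smul_smul,
      ENNReal.inv_mul_cancel two_ne_zero ENNReal.ofNat_ne_top, one_smul]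
  rw [hk.map_eq, Measure.compProd_congr hae]

end ConditionalLaw

section MatrixSpace

theorem isClosedEmbedding_coe_MInfty :
    IsClosedEmbedding (Subtype.val : MInfty → ℕ → ℕ → unitInterval) := by
  refine .subtypeVal ?_
  simp only [ofPred_and, ofPred_forall]
  exact (isClosed_iInter fun i => isClosed_iInter fun j =>
    isClosed_eq (by fun_prop) (by fun_prop)).inter
    (isClosed_iInter fun i => isClosed_eq (by fun_prop) (by fun_prop))

instance : CompactSpace MInfty := isClosedEmbedding_coe_MInfty.compactSpace

instance : SecondCountableTopology MInfty :=
  isClosedEmbedding_coe_MInfty.isEmbedding.secondCountableTopology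

instance : TopologicalSpace.MetrizableSpace MInfty :=
  isClosedEmbedding_coe_MInfty.isEmbedding.metrizableSpace

theorem MInfty.ext {d d' : MInfty} (h : ∀ i j, d.1 i j = d'.1 i j) : d = d' :=
  Subtype.ext (funext₂ h)

theorem continuous_entry (i j : ℕ) : Continuous fun d : MInfty => d.1 i j :=
  (continuous_apply j).comp ((continuous_apply i).comp continuous_subtype_val)

theorem continuous_coe_entry (i j : ℕ) : Continuous fun d : MInfty => (d.1 i j : ℝ) :=
  continuous_subtype_val.comp (continuous_entry i j)

@[fun_prop]
theorem measurable_entry (i j : ℕ) : Measurable fun d : MInfty => d.1 i j :=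
  (continuous_entry i j).measurable

/-- The matrix `(d (σ i) (σ j))` of the points picked by `σ`, which need not be injective. -/
def reindex (σ : ℕ → ℕ) (d : MInfty) : MInfty :=
  ⟨fun i j => d.1 (σ i) (σ j), fun _ _ => d.2.1 _ _, fun _ => d.2.2 _⟩

@[fun_prop]
theorem continuous_reindex (σ : ℕ → ℕ) : Continuous (reindex σ) :=
  .subtype_mk (continuous_pi fun i => continuous_pi fun j => continuous_entry (σ i) (σ j)) _

@[fun_prop]
theorem measurable_reindex (σ : ℕ → ℕ) : Measurable (reindex σ) :=
  (continuous_reindex σ).measurable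

end MatrixSpace

section ExchangeableDissociated

/-- Matrices satisfying the triangle inequality, that is, pseudometrics on `ℕ`. -/
def IsSemimetric (d : MInfty) : Prop :=
  ∀ i j k, (d.1 i k : ℝ) ≤ d.1 i j + d.1 j k

/-- Laws of jointly exchangeable random matrices: the law of the matrix of the points picked by an
injection `σ` does not depend on `σ`. -/
def IsExchangeable (κ : Measure MInfty) : Prop :=
  ∀ σ : ℕ → ℕ, Function.Injective σ → κ.map (reindex σ) = κ

/-- Laws of dissociated random matrices: the submatrices on disjoint sets of points are
independent. To be used together with exchangeability, all of them have law `κ`. -/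
def IsDissociated (κ : Measure MInfty) : Prop :=
  ∀ σ τ : ℕ → ℕ, Function.Injective σ → Function.Injective τ → (∀ i j, σ i ≠ τ j) →
    κ.map (fun d => (reindex σ d, reindex τ d)) = κ.prod κ

/-- Laws of exchangeable dissociated random semimetrics on `ℕ`. They turn out to be the elements of
the sampling compactification. -/
structure IsRandomSemimetric (κ : Measure MInfty) : Prop where
  exchangeable : IsExchangeable κ
  dissociated : IsDissociated κ
  ae_isSemimetric : ∀ᵐ d ∂κ, IsSemimetric d

theorem isClosed_setOf_isSemimetric : IsClosed {d | IsSemimetric d} := by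
  simp only [IsSemimetric, ofPred_forall]
  exact isClosed_iInter fun i => isClosed_iInter fun j => isClosed_iInter fun k =>
    isClosed_le (continuous_coe_entry i k)
      ((continuous_coe_entry i j).add (continuous_coe_entry j k))

theorem isClosed_setOf_ae_mem {X : Type*} [TopologicalSpace X] [MeasurableSpace X]
    [OpensMeasurableSpace X] [HasOuterApproxClosed X] {C : Set X} (hC : IsClosed C) :
    IsClosed {κ : ProbabilityMeasure X | ∀ᵐ x ∂(κ : Measure X), x ∈ C} := by
  have hmem (κ : ProbabilityMeasure X) : (∀ᵐ x ∂(κ : Measure X), x ∈ C) ↔ (κ : Measure X) C = 1 :=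
    mem_ae_iff_prob_eq_one hC.measurableSet
  refine isClosed_iff_forall_filter.2 fun κ F _ hF hκ => (hmem κ).2 (le_antisymm prob_le_one ?_)
  calc (1 : ℝ≥0∞) = F.limsup fun ν : ProbabilityMeasure X => (ν : Measure X) C :=
        ((tendsto_const_nhds.congr' (mem_of_superset (le_principal_iff.1 hF)
          fun ν hν => ((hmem ν).1 hν).symm)).limsup_eq).symm
    _ ≤ (κ : Measure X) C := ProbabilityMeasure.limsup_measure_closed_le_of_tendsto hκ hC

theorem isClosed_setOf_isExchangeable :
    IsClosed {κ : ProbabilityMeasure MInfty | IsExchangeable κ} := by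
  simp only [IsExchangeable, ofPred_forall]
  refine isClosed_iInter fun σ => isClosed_iInter fun _ => ?_
  convert isClosed_eq (ProbabilityMeasure.continuous_map (continuous_reindex σ)) continuous_id
    using 3 with κ
  exact ProbabilityMeasure.toMeasure_injective.eq_iff (a := κ.map _) (b := κ)

theorem isClosed_setOf_isDissociated :
    IsClosed {κ : ProbabilityMeasure MInfty | IsDissociated κ} := by
  simp only [IsDissociated, ofPred_forall]
  refine isClosed_iInter fun σ => isClosed_iInter fun τ => isClosed_iInter fun _ =>
    isClosed_iInter fun _ => isClosed_iInter fun _ => ?_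
  convert isClosed_eq (ProbabilityMeasure.continuous_map
      ((continuous_reindex σ).prodMk (continuous_reindex τ)))
    (ProbabilityMeasure.continuous_prod.comp (continuous_id.prodMk continuous_id)) using 3 with κ
  exact ProbabilityMeasure.toMeasure_injective.eq_iff (a := κ.map _) (b := κ.prod κ)

theorem isClosed_setOf_isRandomSemimetric :
    IsClosed {κ : ProbabilityMeasure MInfty | IsRandomSemimetric κ} := by
  convert isClosed_setOf_isExchangeable.inter (isClosed_setOf_isDissociated.inter
    (isClosed_setOf_ae_mem isClosed_setOf_isSemimetric)) using 1
  exact Set.ext fun κ => ⟨fun h => ⟨h.1, h.2, h.3⟩, fun h => ⟨h.1, h.2.1, h.2.2⟩⟩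

theorem exists_injective_extension {t : ℕ → ℕ} {k : ℕ} (ht : InjOn t (Iio k)) :
    ∃ σ : ℕ → ℕ, Function.Injective σ ∧ ∀ i < k, σ i = t i := by
  let M := ∑ i ∈ Finset.range k, t i
  have hM (i : ℕ) (hi : i < k) : t i ≤ M :=
    Finset.single_le_sum (f := t) (fun _ _ => Nat.zero_le _) (Finset.mem_range.2 hi)
  refine ⟨fun i => if i < k then t i else M + 1 + i, fun i j hij => ?_, fun i hi => if_pos hi⟩
  dsimp only at hij
  split_ifs at hij with hi hj hj
  · exact ht hi hj hij
  · have := hM i hi; omega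
  · have := hM j hj; omega
  · omega

theorem IsExchangeable.ae_isSemimetric {κ : Measure MInfty} (hκ : IsExchangeable κ)
    (h : ∀ᵐ d ∂κ, (d.1 0 2 : ℝ) ≤ d.1 0 1 + d.1 1 2) : ∀ᵐ d ∂κ, IsSemimetric d := by
  simp only [IsSemimetric, ae_all_iff]
  intro i j k
  rcases eq_or_ne i j with rfl | hij
  · exact .of_forall fun d => by simp [d.2.2]
  rcases eq_or_ne j k with rfl | hjk
  · exact .of_forall fun d => by simp [d.2.2]
  rcases eq_or_ne i k with rfl | hik
  · exact .of_forall fun d => by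
      simpa [d.2.2] using add_nonneg (d.1 i j).2.1 (d.1 j i).2.1
  obtain ⟨σ, hσ, hσt⟩ := exists_injective_extension (k := 3)
    (t := fun n => if n = 0 then i else if n = 1 then j else k) fun a ha b hb hab => by
      rw [mem_Iio] at ha hb
      dsimp only at hab
      interval_cases a <;> interval_cases b <;> simp_all [eq_comm]
  rw [← hκ σ hσ] at h
  filter_upwards [ae_of_ae_map (measurable_reindex σ).aemeasurable h] with d hd
  simpa [reindex, hσt] using hd

variable {α : Type*} [MeasurableSpace α] (μ : Measure α) [IsProbabilityMeasure μ]
  {M : (ℕ → α) → ProbabilityMeasure MInfty}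

theorem isExchangeable_bind_infinitePi (hM : Measurable M)
    (h : ∀ σ : ℕ → ℕ, Function.Injective σ → ∀ x,
      (M x : Measure MInfty).map (reindex σ) = M (x ∘ σ)) :
    IsExchangeable ((Measure.infinitePi fun _ => μ).bind fun x => (M x : Measure MInfty)) := by
  intro σ hσ
  have hM : Measurable fun x => (M x : Measure MInfty) := measurable_subtype_coe.comp hM
  rw [map_measure_bind _ hM (by fun_prop)]
  simp only [h σ hσ, Function.comp_def]
  rw [← bind_measure_map (f := fun (x : ℕ → α) i => x (σ i)) _ (by fun_prop) hM,
    Measure.map_infinitePi_infinitePi_of_inj (P := fun _ => μ) hσ]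

theorem isDissociated_bind_infinitePi (hM : Measurable M)
    (h : ∀ σ τ : ℕ → ℕ, Function.Injective σ → Function.Injective τ → (∀ i j, σ i ≠ τ j) → ∀ x,
      (M x : Measure MInfty).map (fun d => (reindex σ d, reindex τ d))
        = (M (x ∘ σ) : Measure MInfty).prod (M (x ∘ τ))) :
    IsDissociated ((Measure.infinitePi fun _ => μ).bind fun x => (M x : Measure MInfty)) := by
  intro σ τ hσ hτ hστ
  have hM' : Measurable fun x => (M x : Measure MInfty) := measurable_subtype_coe.comp hM
  rw [map_measure_bind _ hM' (by fun_prop)]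
  simp only [h σ τ hσ hτ hστ, Function.comp_def]
  rw [← prod_bind_prod _ _ hM hM,
    ← infinitePi_map_pair_of_injective (fun _ => μ) hσ hτ hστ, bind_measure_map _ (by fun_prop)]
  exact ProbabilityMeasure.measurable_fun_prod.comp
    ((hM.comp measurable_fst).prodMk (hM.comp measurable_snd))

theorem MMSpace.isRandomSemimetric_tau (X : MMSpace) :
    IsRandomSemimetric (X.tau : Measure MInfty) := by
  let M (x : ℕ → X.carrier) : ProbabilityMeasure MInfty := ⟨Measure.dirac (X.rho x), inferInstance⟩
  have hM : Measurable M := (Measure.measurable_dirac.comp X.measurable_rho).subtype_mk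
  have htau : (X.tau : Measure MInfty)
      = (Measure.infinitePi fun _ => X.μ).bind fun x => (M x : Measure MInfty) :=
    (Measure.bind_dirac_eq_map _ X.measurable_rho).symm
  rw [htau]
  have hexch := isExchangeable_bind_infinitePi X.μ hM fun σ _ x =>
    Measure.map_dirac' (measurable_reindex σ) (X.rho x)
  refine ⟨hexch, isDissociated_bind_infinitePi X.μ hM fun σ τ _ _ _ x => ?_, ?_⟩
  · exact (Measure.map_dirac' (by fun_prop) (X.rho x)).trans Measure.dirac_prod_dirac.symm
  · rw [← htau]
    exact (ae_map_iff X.measurable_rho.aemeasurable isClosed_setOf_isSemimetric.measurableSet).2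
      (.of_forall fun x i j k => dist_triangle _ _ _)

theorem isRandomSemimetric_of_mem_chiBar {κ : ProbabilityMeasure MInfty} (hκ : κ ∈ chiBar) :
    IsRandomSemimetric (κ : Measure MInfty) :=
  closure_minimal (t := {κ : ProbabilityMeasure MInfty | IsRandomSemimetric κ})
    (range_subset_iff.2 MMSpace.isRandomSemimetric_tau) isClosed_setOf_isRandomSemimetric hκ

end ExchangeableDissociated

section QuantumSampling

/-- The matrix of laws `(s (σ i) (σ j))`. -/
noncomputable def reindexHat (σ : ℕ → ℕ) (s : MHatInfty) : MHatInfty :=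
  ⟨fun i j => s.1 (σ i) (σ j), fun _ _ => s.2.1 _ _, fun _ => s.2.2 _⟩

/-- The action of an injection on the positions above the diagonal. -/
def UpperPair.map {σ : ℕ → ℕ} (hσ : Function.Injective σ) (p : UpperPair) : UpperPair :=
  ⟨(min (σ p.1.1) (σ p.1.2), max (σ p.1.1) (σ p.1.2)), min_lt_max.2 (hσ.ne p.2.ne)⟩

theorem UpperPair.map_eq_map_iff {σ τ : ℕ → ℕ} (hσ : Function.Injective σ)
    (hτ : Function.Injective τ) {p q : UpperPair} :
    UpperPair.map hσ p = UpperPair.map hτ q ↔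
      (σ p.1.1 = τ q.1.1 ∧ σ p.1.2 = τ q.1.2) ∨ (σ p.1.1 = τ q.1.2 ∧ σ p.1.2 = τ q.1.1) := by
  simp only [UpperPair.map, Subtype.mk.injEq, Prod.mk.injEq]
  omega

theorem UpperPair.map_injective {σ : ℕ → ℕ} (hσ : Function.Injective σ) :
    Function.Injective (UpperPair.map hσ) := by
  intro p q h
  rw [UpperPair.map_eq_map_iff hσ hσ] at h
  rcases h with ⟨h1, h2⟩ | ⟨h1, h2⟩
  · exact Subtype.ext (Prod.ext (hσ h1) (hσ h2))
  · have h1 := hσ h1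
    have h2 := hσ h2
    have := p.2
    have := q.2
    omega

theorem reindex_symmFill {σ : ℕ → ℕ} (hσ : Function.Injective σ) (e : UpperPair → unitInterval) :
    reindex σ (symmFill e) = symmFill fun p => e (p.map hσ) := by
  refine Subtype.ext (funext fun i => funext fun j => ?_)
  simp only [reindex, symmFill, UpperPair.map]
  rcases lt_trichotomy i j with h | rfl | h
  · rcases lt_or_gt_of_ne (hσ.ne h.ne) with h' | h'
    · simp [h, h', h'.le]
    · simp [h, h', h'.le, h'.not_gt]
  · simp
  · rcases lt_or_gt_of_ne (hσ.ne h.ne) with h' | h'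
    · simp [h, h', h'.le, h.not_gt, h'.not_gt]
    · simp [h, h', h'.le, h.not_gt]

theorem apply_upperPair_map {σ : ℕ → ℕ} (hσ : Function.Injective σ) (s : MHatInfty)
    (p : UpperPair) : s.1 (p.map hσ).1.1 (p.map hσ).1.2 = s.1 (σ p.1.1) (σ p.1.2) := by
  rcases le_total (σ p.1.1) (σ p.1.2) with h | h
  · simp [UpperPair.map, h]
  · simp [UpperPair.map, h, s.2.1 (σ p.1.2)]

theorem matrixLaw_map_reindex {σ : ℕ → ℕ} (hσ : Function.Injective σ) (s : MHatInfty) :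
    (matrixLaw s : Measure MInfty).map (reindex σ) = matrixLaw (reindexHat σ s) := by
  change ((Measure.infinitePi _).map symmFill).map _ = (Measure.infinitePi _).map symmFill
  rw [Measure.map_map (by fun_prop) measurable_symmFill]
  have h1 : (reindex σ ∘ symmFill) = symmFill ∘ fun e p => e (UpperPair.map hσ p) :=
    funext (reindex_symmFill hσ)
  rw [h1, ← Measure.map_map measurable_symmFill (by fun_prop),
    Measure.map_infinitePi_infinitePi_of_inj (UpperPair.map_injective hσ)]
  simp only [apply_upperPair_map, reindexHat]

theorem matrixLaw_map_reindex_pair {σ τ : ℕ → ℕ} (hσ : Function.Injective σ)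
    (hτ : Function.Injective τ) (hστ : ∀ i j, σ i ≠ τ j) (s : MHatInfty) :
    (matrixLaw s : Measure MInfty).map (fun d => (reindex σ d, reindex τ d))
      = (matrixLaw (reindexHat σ s) : Measure MInfty).prod (matrixLaw (reindexHat τ s)) := by
  change ((Measure.infinitePi _).map symmFill).map _
    = ((Measure.infinitePi _).map symmFill).prod ((Measure.infinitePi _).map symmFill)
  rw [Measure.map_map (by fun_prop) measurable_symmFill,
    Measure.map_prod_map _ _ measurable_symmFill measurable_symmFill]
  have h1 : ((fun d => (reindex σ d, reindex τ d)) ∘ symmFill)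
      = Prod.map symmFill symmFill ∘
        fun e => (fun p => e (UpperPair.map hσ p), fun p => e (UpperPair.map hτ p)) :=
    funext fun e => Prod.ext (reindex_symmFill hσ e) (reindex_symmFill hτ e)
  rw [h1, ← Measure.map_map (measurable_symmFill.prodMap measurable_symmFill) (by fun_prop),
    infinitePi_map_pair_of_injective _ (UpperPair.map_injective hσ)
      (UpperPair.map_injective hτ)]
  · simp only [apply_upperPair_map, reindexHat]
  · intro p q h
    rw [UpperPair.map_eq_map_iff] at h
    rcases h with h | h
    · exact hστ _ _ h.1
    · exact hστ _ _ h.1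

/-- The law of the entries above the diagonal of a sampled matrix. -/
noncomputable def entryLaw {α : Type*} [MeasurableSpace α] (μ : Measure α)
    (d : α → α → ProbabilityMeasure unitInterval) : Measure (UpperPair → unitInterval) :=
  (Measure.infinitePi fun _ : ℕ => μ).bind fun x =>
    Measure.infinitePi fun p : UpperPair => (d (x p.1.1) (x p.1.2) : Measure unitInterval)

theorem measurable_infinitePi_entries {α : Type*} [MeasurableSpace α]
    {d : α → α → ProbabilityMeasure unitInterval} (hd : Measurable (Function.uncurry d)) :
    Measurable fun x : ℕ → α =>
      Measure.infinitePi fun p : UpperPair => (d (x p.1.1) (x p.1.2) : Measure unitInterval) :=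
  measurable_infinitePi fun p => measurable_subtype_coe.comp
    (hd.comp ((measurable_pi_apply (X := fun _ : ℕ => α) p.1.1).prodMk (measurable_pi_apply p.1.2)))

theorem measurable_prod_triple {α : Type*} [MeasurableSpace α]
    {d : α → α → ProbabilityMeasure unitInterval} (hd : Measurable (Function.uncurry d)) :
    Measurable fun t : α × α × α => (d t.1 t.2.1 : Measure unitInterval).prod
      ((d t.2.1 t.2.2 : Measure unitInterval).prod (d t.1 t.2.2 : Measure unitInterval)) := by
  have hd₁ : Measurable fun t : α × α × α => d t.1 t.2.1 :=
    hd.comp (measurable_fst.prodMk measurable_snd.fst)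
  have hd₂ : Measurable fun t : α × α × α => d t.2.1 t.2.2 := hd.comp measurable_snd
  have hd₃ : Measurable fun t : α × α × α => d t.1 t.2.2 :=
    hd.comp (measurable_fst.prodMk measurable_snd.snd)
  have hd₂₃ : Measurable fun t : α × α × α => (d t.2.1 t.2.2).prod (d t.1 t.2.2) :=
    (ProbabilityMeasure.measurable_fun_prod.comp (hd₂.prodMk hd₃)).subtype_mk
  exact ProbabilityMeasure.measurable_fun_prod.comp (hd₁.prodMk hd₂₃)

/-- The three lengths between the first three points, in the order of `QMMSpace.triangle`. -/
def firstTriangle (e : UpperPair → unitInterval) : unitInterval × unitInterval × unitInterval :=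
  (e ⟨(0, 1), by decide⟩, e ⟨(1, 2), by decide⟩, e ⟨(0, 2), by decide⟩)

theorem measurable_firstTriangle : Measurable firstTriangle := by
  unfold firstTriangle
  fun_prop

theorem ae_entryLaw_firstTriangle_iff {α : Type*} [MeasurableSpace α] {μ : Measure α}
    [IsProbabilityMeasure μ] {d : α → α → ProbabilityMeasure unitInterval}
    (hd : Measurable (Function.uncurry d)) {C : Set (unitInterval × unitInterval × unitInterval)}
    (hC : MeasurableSet C) :
    (∀ᵐ e ∂entryLaw μ d, firstTriangle e ∈ C) ↔ ∀ᵐ t : α × α × α ∂(μ.prod (μ.prod μ)),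
      ∀ᵐ l ∂((d t.1 t.2.1 : Measure unitInterval).prod
        ((d t.2.1 t.2.2 : Measure unitInterval).prod (d t.1 t.2.2 : Measure unitInterval))),
      l ∈ C := by
  let L (t : α × α × α) := (d t.1 t.2.1 : Measure unitInterval).prod
    ((d t.2.1 t.2.2 : Measure unitInterval).prod (d t.1 t.2.2 : Measure unitInterval))
  let π (x : ℕ → α) := (x 0, x 1, x 2)
  have hπ : Measurable π := by fun_prop
  have hL : Measurable L := measurable_prod_triple hd
  have hLC : Measurable fun t => L t Cᶜ := (Measure.measurable_coe hC.compl).comp hL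
  have hmap (x : ℕ → α) : (Measure.infinitePi fun p : UpperPair =>
      (d (x p.1.1) (x p.1.2) : Measure unitInterval)).map firstTriangle = L (π x) :=
    infinitePi_map_eval_triple _ (by decide) (by decide) (by decide)
  calc (∀ᵐ e ∂entryLaw μ d, firstTriangle e ∈ C)
      ↔ (entryLaw μ d).map firstTriangle Cᶜ = 0 := by
        rw [Measure.map_apply measurable_firstTriangle hC.compl]
        rfl
    _ ↔ ∀ᵐ x ∂Measure.infinitePi fun _ : ℕ => μ, L (π x) Cᶜ = 0 := by
        rw [entryLaw, map_measure_bind _ (measurable_infinitePi_entries hd)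
          measurable_firstTriangle]
        simp only [hmap]
        rw [Measure.bind_apply (f := fun x => L (π x)) hC.compl (hL.comp hπ).aemeasurable,
          lintegral_eq_zero_iff (f := fun x => L (π x) Cᶜ) (hLC.comp hπ)]
        rfl
    _ ↔ _ := by
        rw [← infinitePi_map_eval_triple (fun _ : ℕ => μ) (i := 0) (j := 1) (k := 2)
          (by decide) (by decide) (by decide)]
        exact (ae_map_iff hπ.aemeasurable (hLC (measurableSet_singleton 0))).symm

/-- The triples of lengths that satisfy the triangle inequalities. -/
def triangleSet : Set (unitInterval × unitInterval × unitInterval) :=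
  {l | (l.1 : ℝ) ≤ l.2.1 + l.2.2 ∧ (l.2.1 : ℝ) ≤ l.1 + l.2.2 ∧ (l.2.2 : ℝ) ≤ l.1 + l.2.1}

theorem measurableSet_triangleSet : MeasurableSet triangleSet := by
  simp only [triangleSet, ofPred_and]
  exact (measurableSet_le (by fun_prop) (by fun_prop)).inter
    ((measurableSet_le (by fun_prop) (by fun_prop)).inter
      (measurableSet_le (by fun_prop) (by fun_prop)))

theorem firstTriangle_mem_triangleSet {e : UpperPair → unitInterval}
    (he : IsSemimetric (symmFill e)) : firstTriangle e ∈ triangleSet := by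
  refine ⟨?_, ?_, ?_⟩
  · simpa [symmFill, firstTriangle, add_comm] using he 0 2 1
  · simpa [symmFill, firstTriangle] using he 1 0 2
  · simpa [symmFill, firstTriangle] using he 0 1 2

namespace QMMSpace

theorem coe_tau (X : QMMSpace.{u}) : (X.tau : Measure MInfty)
    = (Measure.infinitePi fun _ : ℕ => X.μ).bind
      fun x => (matrixLaw (X.rhoHat x) : Measure MInfty) := by
  change (((Measure.infinitePi fun _ : ℕ => X.μ).map X.rhoHat).map matrixLaw).bind _ = _
  rw [bind_measure_map _ measurable_matrixLaw (k := fun m => (m : Measure MInfty))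
      measurable_subtype_coe,
    bind_measure_map _ X.measurable_rhoHat (k := fun s => (matrixLaw s : Measure MInfty))
      (measurable_subtype_coe.comp measurable_matrixLaw)]

theorem coe_tau_eq_map_entryLaw (X : QMMSpace.{u}) :
    (X.tau : Measure MInfty) = (entryLaw X.μ X.d).map symmFill := by
  rw [coe_tau, entryLaw, map_measure_bind _ (measurable_infinitePi_entries X.measurable_d)
    measurable_symmFill]
  rfl

theorem isRandomSemimetric_tau (X : QMMSpace.{u}) :
    IsRandomSemimetric (X.tau : Measure MInfty) := by
  have hM : Measurable fun x => matrixLaw (X.rhoHat x) :=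
    measurable_matrixLaw.comp X.measurable_rhoHat
  have hexch : IsExchangeable (X.tau : Measure MInfty) := by
    rw [coe_tau]
    exact isExchangeable_bind_infinitePi X.μ hM fun σ hσ x => matrixLaw_map_reindex hσ (X.rhoHat x)
  refine ⟨hexch, ?_, hexch.ae_isSemimetric ?_⟩
  · rw [coe_tau]
    exact isDissociated_bind_infinitePi X.μ hM fun σ τ hσ hτ hστ x =>
      matrixLaw_map_reindex_pair hσ hτ hστ (X.rhoHat x)
  · have htri := (ae_entryLaw_firstTriangle_iff X.measurable_d measurableSet_triangleSet).2
      X.triangle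
    have hC : MeasurableSet {d : MInfty | (d.1 0 2 : ℝ) ≤ d.1 0 1 + d.1 1 2} :=
      (isClosed_le (continuous_coe_entry 0 2)
        ((continuous_coe_entry 0 1).add (continuous_coe_entry 1 2))).measurableSet
    rw [coe_tau_eq_map_entryLaw]
    refine (ae_map_iff measurable_symmFill.aemeasurable hC).2 ?_
    filter_upwards [htri] with e he
    simpa [symmFill, firstTriangle] using he.2.2

end QMMSpace

end QuantumSampling

section RandomLabels

/-- A diffuse probability measure of full support on the line. It labels points by real numbers. -/
noncomputable abbrev labelMeasure : Measure ℝ := gaussianReal 0 1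

instance : NullSingletonClass labelMeasure := nullSingletonClass_gaussianReal one_ne_zero

/-- The number of the interval `[k / (n + 1), (k + 1) / (n + 1))` that contains `u`, for an
enumeration of the integers `k` by natural numbers. -/
noncomputable def cell (n : ℕ) (u : ℝ) : ℕ := Equiv.intEquivNat ⌊(n + 1) * u⌋

@[fun_prop]
theorem measurable_cell (n : ℕ) : Measurable (cell n) :=
  (measurable_of_countable Equiv.intEquivNat).comp
    (Int.measurable_floor.comp (measurable_const.mul measurable_id))

/-- The law of the number of the cell of a random label. -/
noncomputable def cellLaw (n : ℕ) : Measure ℕ := labelMeasure.map (cell n)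

instance (n : ℕ) : IsProbabilityMeasure (cellLaw n) :=
  Measure.isProbabilityMeasure_map (measurable_cell n).aemeasurable

theorem eventually_cell_ne {u v : ℝ} (h : u ≠ v) : ∀ᶠ n in atTop, cell n u ≠ cell n v := by
  have hlim : Tendsto (fun n : ℕ => ((n : ℝ) + 1) * |u - v|) atTop atTop :=
    (tendsto_natCast_atTop_atTop.atTop_add tendsto_const_nhds).atTop_mul_const
      (abs_pos.2 (sub_ne_zero.2 h))
  filter_upwards [hlim.eventually_gt_atTop 1] with n hn heq
  have hlt := Int.abs_sub_lt_one_of_floor_eq_floor (Equiv.intEquivNat.injective heq)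
  rw [← mul_sub, abs_mul, abs_of_pos (by positivity)] at hlt
  exact hn.not_gt hlt

theorem cellLaw_singleton_ne_zero (n m : ℕ) : cellLaw n {m} ≠ 0 := by
  obtain ⟨z, rfl⟩ := Equiv.intEquivNat.surjective m
  have hn : (0 : ℝ) < n + 1 := by positivity
  have hsub : Ioo ((z : ℝ) / (n + 1)) ((z + 1) / (n + 1)) ⊆ cell n ⁻¹' {Equiv.intEquivNat z} := by
    rintro u ⟨hzu, huz⟩
    rw [div_lt_iff₀' hn] at hzu
    rw [lt_div_iff₀' hn] at huz
    exact congrArg Equiv.intEquivNat (Int.floor_eq_iff.2 ⟨hzu.le, huz⟩)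
  rw [cellLaw, Measure.map_apply (measurable_cell n) (measurableSet_singleton _)]
  intro h
  have hvol := gaussianReal_absolutelyContinuous' 0 one_ne_zero (measure_mono_null hsub h)
  rw [Real.volume_Ioo, ENNReal.ofReal_eq_zero, sub_nonpos, div_le_div_iff_of_pos_right hn] at hvol
  linarith

end RandomLabels

section SampleMean

/-- The mean of `f` over the matrices of the points of `(ℕ, d)` picked by independent random indices
of law `ν`. -/
noncomputable def sampleMean (ν : Measure ℕ) (f : MInfty → ℝ) (d : MInfty) : ℝ :=
  ∫ t, f (reindex t d) ∂Measure.infinitePi fun _ : ℕ => ν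

/-- The product of the values of `f` at two submatrices without common points. -/
def disjointProduct (f : MInfty → ℝ) (d : MInfty) : ℝ :=
  f (reindex (fun i => 2 * i) d) * f (reindex (fun i => 2 * i + 1) d)

theorem exists_forall_abs_sub_lt_of_entries_eq {f : MInfty → ℝ} (hf : Continuous f) {ε : ℝ}
    (hε : 0 < ε) :
    ∃ k : ℕ, ∀ d d' : MInfty, (∀ i < k, ∀ j < k, d.1 i j = d'.1 i j) → |f d - f d'| < ε := by
  by_contra! h
  choose x y hxy hfxy using h
  obtain ⟨a, φ, hφ, hxa⟩ := CompactSpace.tendsto_subseq x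
  have hya : Tendsto (y ∘ φ) atTop (𝓝 a) := by
    refine tendsto_subtype_rng.2 (tendsto_pi_nhds.2 fun i => tendsto_pi_nhds.2 fun j => ?_)
    refine (((continuous_entry i j).tendsto a).comp hxa).congr' ?_
    filter_upwards [eventually_gt_atTop i, eventually_gt_atTop j] with k hi hj
    exact hxy (φ k) i (hi.trans_le (hφ.id_le k)) j (hj.trans_le (hφ.id_le k))
  have hlim : Tendsto (fun k => |f (x (φ k)) - f (y (φ k))|) atTop (𝓝 0) := by
    simpa using (((hf.tendsto a).comp hxa).sub ((hf.tendsto a).comp hya)).abs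
  exact (ge_of_tendsto' hlim fun k => hfxy (φ k)).not_gt hε

theorem integrable_comp_of_continuous {Ω : Type*} [MeasurableSpace Ω] {P : Measure Ω}
    [IsFiniteMeasure P] {f : MInfty → ℝ} (hf : Continuous f) {g : Ω → MInfty} (hg : Measurable g) :
    Integrable (fun ω => f (g ω)) P := by
  obtain ⟨C, hC⟩ := isCompact_univ.exists_bound_of_continuousOn hf.continuousOn
  exact Integrable.of_bound (hf.measurable.comp hg).aestronglyMeasurable C
    (.of_forall fun d => hC _ (mem_univ _))

@[fun_prop]
theorem measurable_reindex_uncurry :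
    Measurable fun p : MInfty × (ℕ → ℕ) => reindex p.2 p.1 := by
  refine Measurable.subtype_mk (measurable_pi_lambda _ fun i => measurable_pi_lambda _ fun j => ?_)
  have hentry : Measurable fun q : (ℕ × ℕ) × MInfty => q.2.1 q.1.1 q.1.2 :=
    measurable_from_prod_countable_right fun q => measurable_entry q.1 q.2
  have hindex : Measurable fun p : MInfty × (ℕ → ℕ) => ((p.2 i, p.2 j), p.1) := by fun_prop
  exact hentry.comp hindex

theorem measurable_reindex_left (d : MInfty) : Measurable fun t => reindex t d :=
  measurable_reindex_uncurry.comp (measurable_const.prodMk measurable_id)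

variable {f : MInfty → ℝ} (hf : Continuous f)
include hf

theorem continuous_disjointProduct : Continuous (disjointProduct f) :=
  (hf.comp (continuous_reindex _)).mul (hf.comp (continuous_reindex _))

theorem sampleMean_disjointProduct (ν : Measure ℕ) [IsProbabilityMeasure ν] (d : MInfty) :
    sampleMean ν (disjointProduct f) d = sampleMean ν f d ^ 2 := by
  have hfm (g : (ℕ → ℕ) × (ℕ → ℕ) → ℕ → ℕ) (hg : Measurable g) :
      Measurable fun p => f (reindex (g p) d) :=
    hf.measurable.comp ((measurable_reindex_left d).comp hg)
  rw [sq, sampleMean, sampleMean, ← integral_prod_mul,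
    ← infinitePi_map_pair_of_injective (fun _ : ℕ => ν) (σ := fun i => 2 * i)
      (τ := fun i => 2 * i + 1) (fun a b h => by simpa using h) (fun a b h => by simpa using h)
      (fun i j => by omega),
    integral_map (by fun_prop)
      (by exact ((hfm _ measurable_fst).mul (hfm _ measurable_snd)).aestronglyMeasurable)]
  rfl

theorem IsDissociated.integral_disjointProduct {κ : Measure MInfty} [IsProbabilityMeasure κ]
    (hκ : IsDissociated κ) : ∫ d, disjointProduct f d ∂κ = (∫ d, f d ∂κ) ^ 2 := by
  rw [sq, ← integral_prod_mul,
    ← hκ (fun i => 2 * i) (fun i => 2 * i + 1) (fun a b h => by simpa using h)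
      (fun a b h => by simpa using h) (fun i j => by omega), integral_map (by fun_prop)]
  · rfl
  · exact ((hf.comp continuous_fst).mul (hf.comp continuous_snd)).aestronglyMeasurable

variable {κ : Measure MInfty} [IsProbabilityMeasure κ]

theorem integrable_sampleMean (ν : Measure ℕ) [IsProbabilityMeasure ν] :
    Integrable (sampleMean ν f) κ :=
  (integrable_comp_of_continuous (P := κ.prod (Measure.infinitePi fun _ : ℕ => ν)) hf
    measurable_reindex_uncurry).integral_prod_left

theorem integrable_sq_sampleMean_sub (ν : Measure ℕ) [IsProbabilityMeasure ν] (c : ℝ) :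
    Integrable (fun d => (sampleMean ν f d - c) ^ 2) κ := by
  simp only [sub_sq, ← sampleMean_disjointProduct hf, mul_right_comm]
  exact ((integrable_sampleMean (continuous_disjointProduct hf) ν).sub
    ((integrable_sampleMean hf ν).const_mul _)).add (integrable_const _)

theorem integral_sq_sampleMean_sub (ν : Measure ℕ) [IsProbabilityMeasure ν] (c : ℝ) :
    ∫ d, (sampleMean ν f d - c) ^ 2 ∂κ = ∫ d, sampleMean ν (disjointProduct f) d ∂κ
      - 2 * c * ∫ d, sampleMean ν f d ∂κ + c ^ 2 := by
  have hi := integrable_sampleMean (κ := κ) (continuous_disjointProduct hf) ν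
  have hi' := (integrable_sampleMean (κ := κ) hf ν).const_mul (2 * c)
  simp only [sub_sq, ← sampleMean_disjointProduct hf, mul_right_comm]
  rw [integral_add (by exact hi.sub hi') (integrable_const _), integral_sub hi hi',
    integral_const_mul]
  simp

theorem IsExchangeable.tendsto_integral_reindex (hκ : IsExchangeable κ) {t : ℕ → ℕ → ℕ}
    (ht : ∀ i j, i ≠ j → ∀ᶠ n in atTop, t n i ≠ t n j) :
    Tendsto (fun n => ∫ d, f (reindex (t n) d) ∂κ) atTop (𝓝 (∫ d, f d ∂κ)) := by
  rw [Metric.tendsto_nhds]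
  intro ε hε
  obtain ⟨k, hk⟩ := exists_forall_abs_sub_lt_of_entries_eq hf (half_pos hε)
  have hinj : ∀ᶠ n in atTop, InjOn (t n) (Iio k) := by
    have hev : ∀ᶠ n in atTop, ∀ i ∈ Iio k, ∀ j ∈ Iio k, i ≠ j → t n i ≠ t n j := by
      simp only [(finite_Iio k).eventually_all]
      exact fun i _ j _ => eventually_imp_distrib_left.2 (ht i j)
    filter_upwards [hev] with n hn i hi j hj using not_imp_not.1 (hn i hi j hj)
  filter_upwards [hinj] with n hn
  obtain ⟨σ, hσ, hσt⟩ := exists_injective_extension hn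
  have hint (σ : ℕ → ℕ) := integrable_comp_of_continuous (P := κ) hf (measurable_reindex σ)
  have hexch : ∫ d, f d ∂κ = ∫ d, f (reindex σ d) ∂κ := by
    conv_lhs => rw [← hκ σ hσ]
    exact integral_map (measurable_reindex σ).aemeasurable hf.aestronglyMeasurable
  rw [hexch, dist_eq_norm, ← integral_sub (hint _) (hint _)]
  calc ‖∫ d, f (reindex (t n) d) - f (reindex σ d) ∂κ‖ ≤ ε / 2 * κ.real univ :=
        norm_integral_le_of_norm_le_const (.of_forall fun d => (hk _ _ fun i hi j hj => by
          simp [reindex, hσt i hi, hσt j hj]).le)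
    _ < ε := by simp [hε]

theorem integral_sampleMean (ν : Measure ℕ) [IsProbabilityMeasure ν] :
    ∫ d, sampleMean ν f d ∂κ
      = ∫ t, ∫ d, f (reindex t d) ∂κ ∂Measure.infinitePi fun _ : ℕ => ν :=
  integral_integral_swap (integrable_comp_of_continuous
    (P := κ.prod (Measure.infinitePi fun _ : ℕ => ν)) hf measurable_reindex_uncurry)

theorem stronglyMeasurable_integral_reindex :
    StronglyMeasurable fun t => ∫ d, f (reindex t d) ∂κ :=
  (hf.measurable.comp measurable_reindex_uncurry).stronglyMeasurable.integral_prod_left'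

theorem IsExchangeable.tendsto_integral_sampleMean (hκ : IsExchangeable κ) :
    Tendsto (fun n => ∫ d, sampleMean (cellLaw n) f d ∂κ) atTop (𝓝 (∫ d, f d ∂κ)) := by
  let θ : Measure (ℕ → ℝ) := Measure.infinitePi fun _ => labelMeasure
  have hcell (n : ℕ) : Measurable fun (u : ℕ → ℝ) i => cell n (u i) := by fun_prop
  have hmeas := stronglyMeasurable_integral_reindex (κ := κ) hf
  have hlabel (n : ℕ) : ∫ d, sampleMean (cellLaw n) f d ∂κ
      = ∫ u, ∫ d, f (reindex (fun i => cell n (u i)) d) ∂κ ∂θ := by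
    rw [integral_sampleMean hf]
    simp only [cellLaw]
    rw [← Measure.infinitePi_map_pi (fun _ : ℕ => labelMeasure) fun _ => measurable_cell n]
    exact integral_map (hcell n).aemeasurable hmeas.aestronglyMeasurable
  simp only [hlabel]
  obtain ⟨C, hC⟩ := isCompact_univ.exists_bound_of_continuousOn hf.continuousOn
  rw [show ∫ d, f d ∂κ = ∫ _u, ∫ d, f d ∂κ ∂θ by simp]
  refine tendsto_integral_of_dominated_convergence (fun _ => C)
    (fun n => (hmeas.comp_measurable (hcell n)).aestronglyMeasurable) (integrable_const C)
    (fun n => .of_forall fun u => ?_) ?_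
  · simpa using norm_integral_le_of_norm_le_const (μ := κ) (.of_forall fun d => hC _ (mem_univ _))
  · filter_upwards [ae_injective_infinitePi labelMeasure] with u hu
    exact hκ.tendsto_integral_reindex hf fun i j hij => eventually_cell_ne (hu.ne hij)

-- By dissociation `f` is asymptotically uncorrelated with itself along two independent samples, so
-- the variance of its sample mean vanishes in the limit.
theorem IsRandomSemimetric.tendsto_integral_sq_sampleMean_sub (hκ : IsRandomSemimetric κ) :
    Tendsto (fun n => ∫ d, (sampleMean (cellLaw n) f d - ∫ d, f d ∂κ) ^ 2 ∂κ) atTop (𝓝 0) := by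
  simp only [integral_sq_sampleMean_sub hf]
  have hsq := hκ.exchangeable.tendsto_integral_sampleMean (continuous_disjointProduct hf)
  rw [hκ.dissociated.integral_disjointProduct hf] at hsq
  have hlim := (hsq.sub ((hκ.exchangeable.tendsto_integral_sampleMean hf).const_mul
    (2 * ∫ d, f d ∂κ))).add_const ((∫ d, f d ∂κ) ^ 2)
  convert hlim using 2
  ring

end SampleMean

section CompletionSpace

variable {S : Type} [PseudoMetricSpace S] [MeasurableSpace S]

/-- The matrix of distances between the terms of a sequence. -/
def distMatrix (hS : ∀ x y : S, dist x y ≤ 1) (x : ℕ → S) : MInfty :=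
  ⟨fun i j => ⟨dist (x i) (x j), dist_nonneg, hS _ _⟩,
    fun i j => Subtype.ext (dist_comm (x i) (x j)), fun i => Subtype.ext (dist_self (x i))⟩

theorem measurable_distMatrix [OpensMeasurableSpace S] [SecondCountableTopology S]
    (hS : ∀ x y : S, dist x y ≤ 1) : Measurable (distMatrix hS) := by
  refine Measurable.subtype_mk (measurable_pi_lambda _ fun i => measurable_pi_lambda _ fun j => ?_)
  exact Measurable.subtype_mk ((measurable_pi_apply i).dist (measurable_pi_apply j))

theorem isOpenPosMeasure_map_of_denseRange {X Y : Type*} [TopologicalSpace X] [MeasurableSpace X]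
    [OpensMeasurableSpace X] [TopologicalSpace Y] [MeasurableSpace Y] [BorelSpace Y] {f : X → Y}
    (hf : Continuous f) (hf' : DenseRange f) (μ : Measure X) [μ.IsOpenPosMeasure] :
    (μ.map f).IsOpenPosMeasure := by
  refine ⟨fun U hU hne => ?_⟩
  rw [Measure.map_apply hf.measurable hU.measurableSet]
  exact (hU.preimage hf).measure_ne_zero μ (hf'.exists_mem_open hU hne)

instance : MeasurableSpace (UniformSpace.Completion S) := borel _

instance : BorelSpace (UniformSpace.Completion S) := ⟨rfl⟩

/-- The completion of a pseudometric space with a measure of full support. -/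
noncomputable def MMSpace.completion [BorelSpace S] [TopologicalSpace.SeparableSpace S]
    (hS : ∀ x y : S, dist x y ≤ 1) (μ : Measure S) [IsProbabilityMeasure μ]
    [μ.IsOpenPosMeasure] : MMSpace where
  carrier := UniformSpace.Completion S
  dist_le_one x y := UniformSpace.Completion.induction_on₂ x y
    (isClosed_le continuous_dist continuous_const) fun a b =>
      (UniformSpace.Completion.dist_eq a b).trans_le (hS a b)
  μ := μ.map (↑)
  prob := Measure.isProbabilityMeasure_map
    (UniformSpace.Completion.continuous_coe S).measurable.aemeasurable
  fullSupport := isOpenPosMeasure_map_of_denseRange (UniformSpace.Completion.continuous_coe S)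
    UniformSpace.Completion.denseRange_coe μ

theorem MMSpace.coe_tau_completion [BorelSpace S] [TopologicalSpace.SeparableSpace S]
    (hS : ∀ x y : S, dist x y ≤ 1) (μ : Measure S) [IsProbabilityMeasure μ]
    [μ.IsOpenPosMeasure] : ((completion hS μ).tau : Measure MInfty)
      = (Measure.infinitePi fun _ : ℕ => μ).map (distMatrix hS) := by
  let φ : S → (completion hS μ).carrier := UniformSpace.Completion.coe'
  have hφ : Measurable φ := (UniformSpace.Completion.continuous_coe S).measurable
  have := Measure.isProbabilityMeasure_map (μ := μ) hφ.aemeasurable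
  have hdist : distMatrix hS = (completion hS μ).rho ∘ fun x i => φ (x i) :=
    funext fun x => MInfty.ext fun i j =>
      Subtype.ext (UniformSpace.Completion.dist_eq (x i) (x j)).symm
  rw [hdist, ← Measure.map_map (measurable_rho _) (by fun_prop),
    Measure.infinitePi_map_pi (fun _ : ℕ => μ) fun _ => hφ]
  rfl

/-- The natural numbers with the pseudometric `d`, on a type of its own because `ℕ` already carries
a metric. -/
structure IndexSpace {d : MInfty} (hd : IsSemimetric d) : Type where
  index : ℕ

variable {d : MInfty} (hd : IsSemimetric d)

instance : Countable (IndexSpace hd) :=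
  Function.Injective.countable (f := IndexSpace.index) fun ⟨_⟩ ⟨_⟩ h => congrArg _ h

noncomputable instance : PseudoMetricSpace (IndexSpace hd) where
  dist i j := (d.1 i.index j.index : ℝ)
  dist_self i := by simp [d.2.2]
  dist_comm i j := by rw [d.2.1]
  dist_triangle i j k := hd i.index j.index k.index

noncomputable instance : MeasurableSpace (IndexSpace hd) := borel _

instance : BorelSpace (IndexSpace hd) := ⟨rfl⟩

include hd in
theorem exists_mmSpace_tau_eq (ν : Measure ℕ) [IsProbabilityMeasure ν] (hν : ∀ m, ν {m} ≠ 0) :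
    ∃ Y : MMSpace, (Y.tau : Measure MInfty)
      = (Measure.infinitePi fun _ : ℕ => ν).map fun t => reindex t d := by
  have hmk : Measurable (IndexSpace.mk : ℕ → IndexSpace hd) := measurable_of_countable _
  have hprob := Measure.isProbabilityMeasure_map (μ := ν) hmk.aemeasurable
  have hsupp : (ν.map (IndexSpace.mk : ℕ → IndexSpace hd)).IsOpenPosMeasure := by
    refine ⟨fun U hU ⟨m, hm⟩ hU0 => hν m.index ?_⟩
    rw [Measure.map_apply hmk hU.measurableSet] at hU0
    exact measure_mono_null (singleton_subset_iff.2 hm) hU0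
  refine ⟨.completion (S := IndexSpace hd) (fun i j => (d.1 i.index j.index).2.2) (ν.map .mk), ?_⟩
  rw [MMSpace.coe_tau_completion, ← Measure.infinitePi_map_pi (fun _ : ℕ => ν) fun _ => hmk,
    Measure.map_map (measurable_distMatrix _) (by fun_prop)]
  rfl

end CompletionSpace

section ApproximationBySamples

theorem IsRandomSemimetric.exists_mmSpace_integral_near {κ : Measure MInfty}
    [IsProbabilityMeasure κ] (hκ : IsRandomSemimetric κ) (s : Finset (MInfty →ᵇ ℝ)) {ε : ℝ}
    (hε : 0 < ε) :
    ∃ Y : MMSpace, ∀ f ∈ s, |∫ d, f d ∂(Y.tau : Measure MInfty) - ∫ d, f d ∂κ| < ε := by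
  let V (n : ℕ) (d : MInfty) := ∑ f ∈ s, (sampleMean (cellLaw n) f d - ∫ d, f d ∂κ) ^ 2
  have hV (n : ℕ) (f : MInfty →ᵇ ℝ) := integrable_sq_sampleMean_sub (κ := κ) f.continuous
    (cellLaw n) (∫ d, f d ∂κ)
  have hlim : Tendsto (fun n => ∫ d, V n d ∂κ) atTop (𝓝 0) := by
    simp only [V, integral_finsetSum s fun f _ => hV _ f]
    simpa using tendsto_finsetSum s fun f _ => hκ.tendsto_integral_sq_sampleMean_sub f.continuous
  obtain ⟨n, hn⟩ := (hlim.eventually (gt_mem_nhds (pow_pos hε 2))).exists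
  obtain ⟨d, hd, hdn⟩ := exists_notMem_null_le_integral
    (integrable_finsetSum s fun f _ => hV n f) (ae_iff.1 hκ.ae_isSemimetric)
  obtain ⟨Y, hY⟩ := exists_mmSpace_tau_eq (not_not.1 hd) (cellLaw n) (cellLaw_singleton_ne_zero n)
  refine ⟨Y, fun f hf => ?_⟩
  rw [hY, integral_map (measurable_reindex_left d).aemeasurable f.continuous.aestronglyMeasurable]
  refine abs_lt_of_sq_lt_sq ?_ hε.le
  calc (sampleMean (cellLaw n) f d - ∫ d, f d ∂κ) ^ 2 ≤ V n d :=
        Finset.single_le_sum (f := fun f : MInfty →ᵇ ℝ =>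
          (sampleMean (cellLaw n) f d - ∫ d, f d ∂κ) ^ 2) (fun _ _ => sq_nonneg _) hf
    _ < ε ^ 2 := hdn.trans_lt hn

theorem IsRandomSemimetric.mem_chiBar {κ : ProbabilityMeasure MInfty}
    (hκ : IsRandomSemimetric (κ : Measure MInfty)) : κ ∈ chiBar := by
  classical
  choose Y hY using fun q : Finset (MInfty →ᵇ ℝ) × ℕ =>
    hκ.exists_mmSpace_integral_near q.1 (Nat.one_div_pos_of_nat (α := ℝ) (n := q.2))
  refine mem_closure_of_tendsto (f := fun q => (Y q).tau) (b := atTop) ?_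
    (.of_forall fun q => mem_range_self _)
  refine ProbabilityMeasure.tendsto_iff_forall_integral_tendsto.2 fun f =>
    Metric.tendsto_nhds.2 fun ε hε => ?_
  obtain ⟨m, hm⟩ := exists_nat_one_div_lt hε
  filter_upwards [eventually_ge_atTop (({f} : Finset (MInfty →ᵇ ℝ)), m)] with q hq
  exact (hY q f (hq.1 (Finset.mem_singleton_self f))).trans
    ((Nat.one_div_le_one_div hq.2).trans_lt hm)

end ApproximationBySamples

section ReferencePoints

/-- The entries above the diagonal. -/
def upperEntries (d : MInfty) : UpperPair → unitInterval := fun p => d.1 p.1.1 p.1.2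

theorem measurable_upperEntries : Measurable upperEntries :=
  measurable_pi_lambda _ fun _ => measurable_entry _ _

theorem symmFill_upperEntries (d : MInfty) : symmFill (upperEntries d) = d := by
  refine MInfty.ext fun i j => ?_
  rcases lt_trichotomy i j with h | rfl | h
  · simp [symmFill, upperEntries, h]
  · simp [symmFill, d.2.2]
  · simp [symmFill, upperEntries, h, h.not_gt, d.2.1 j i]

/-- The sample points are the even indices. -/
def sampleMatrix (d : MInfty) : MInfty := reindex (fun i => 2 * i) d

/-- The reference points are the odd indices. Those congruent to `1` modulo `4` are of the first
kind, those congruent to `3` of the second kind. -/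
def referenceMatrix (d : MInfty) : MInfty := reindex (fun i => 2 * i + 1) d

/-- The distances of the `n`-th sample point to the reference points of the first kind. -/
def referenceRow (n : ℕ) (d : MInfty) : ℕ → unitInterval := fun g => d.1 (2 * n) (4 * g + 1)

/-- A semimetric on reference points of the first kind together with the rows of two further
points. -/
abbrev PairProfile := MInfty × (ℕ → unitInterval) × (ℕ → unitInterval)

/-- What the reference points of the first kind know about two sample points. -/
def pairProfile (m n : ℕ) (d : MInfty) : PairProfile :=
  (reindex (fun g => 4 * g + 1) d, referenceRow m d, referenceRow n d)

/-- The profile of the `m`-th and the `n`-th sample point, as a function of the reference matrix and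
the rows of all sample points. -/
def extractProfile (p : UpperPair) (z : MInfty × (ℕ → ℕ → unitInterval)) : PairProfile :=
  (reindex (fun g => 2 * g) z.1, z.2 p.1.1, z.2 p.1.2)

@[fun_prop]
theorem measurable_sampleMatrix : Measurable sampleMatrix := measurable_reindex _

@[fun_prop]
theorem measurable_referenceMatrix : Measurable referenceMatrix := measurable_reindex _

@[fun_prop]
theorem measurable_referenceRow (n : ℕ) : Measurable (referenceRow n) :=
  measurable_pi_lambda _ fun _ => measurable_entry _ _

theorem measurable_pairProfile (m n : ℕ) : Measurable (pairProfile m n) := by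
  unfold pairProfile
  fun_prop

theorem measurable_extractProfile (p : UpperPair) : Measurable (extractProfile p) := by
  unfold extractProfile
  fun_prop

theorem extractProfile_referenceMatrix (p : UpperPair) (d : MInfty) :
    extractProfile p (referenceMatrix d, fun n => referenceRow n d)
      = pairProfile p.1.1 p.1.2 d := by
  refine Prod.ext (MInfty.ext fun i j => ?_) rfl
  change d.1 (2 * (2 * i) + 1) (2 * (2 * j) + 1) = d.1 (4 * i + 1) (4 * j + 1)
  simp only [← mul_assoc, Nat.reduceMul]

theorem IsExchangeable.measurePreserving_reindex {κ : Measure MInfty} (hκ : IsExchangeable κ)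
    {σ : ℕ → ℕ} (hσ : Function.Injective σ) : MeasurePreserving (reindex σ) κ κ :=
  ⟨measurable_reindex σ, hκ σ hσ⟩

end ReferencePoints

section Rows

/-- Fixes the `n`-th sample point and the reference points of the first kind, and moves all other
points to reference points of the second kind. -/
def hideOtherPoints (n m : ℕ) : ℕ := if m % 4 = 1 ∨ m = 2 * n then m else 4 * m + 3

theorem hideOtherPoints_injective (n : ℕ) : Function.Injective (hideOtherPoints n) := by
  intro l m h
  simp only [hideOtherPoints] at h
  split_ifs at h <;> omega

/-- The reference matrix and the rows of the sample points other than the `n`-th one, after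
`hideOtherPoints n`, as a function of the original reference matrix. -/
def hiddenRows (n : ℕ) (D : MInfty) : MInfty × ({m : ℕ // m ≠ n} → ℕ → unitInterval) :=
  (reindex (fun i => if i % 2 = 0 then i else 4 * i + 3) D,
    fun m g => D.1 (4 * m + 1) (2 * g))

theorem hiddenRows_referenceMatrix (n : ℕ) (d : MInfty) :
    hiddenRows n (referenceMatrix d) = (referenceMatrix (reindex (hideOtherPoints n) d),
      fun m : {m : ℕ // m ≠ n} => referenceRow m (reindex (hideOtherPoints n) d)) := by
  have hodd (i : ℕ) : hideOtherPoints n (2 * i + 1)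
      = 2 * (if i % 2 = 0 then i else 4 * i + 3) + 1 := by
    simp only [hideOtherPoints]
    split_ifs <;> omega
  have hrow (g : ℕ) : hideOtherPoints n (4 * g + 1) = 2 * (2 * g) + 1 := by
    simp only [hideOtherPoints]
    split_ifs <;> omega
  have hsample (m : ℕ) (hm : m ≠ n) : hideOtherPoints n (2 * m) = 2 * (4 * m + 1) + 1 := by
    simp only [hideOtherPoints]
    split_ifs <;> omega
  refine Prod.ext (MInfty.ext fun i j => ?_) (funext fun m => funext fun g => ?_)
  · simp only [hiddenRows, referenceMatrix, reindex, hodd]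
  · simp only [hiddenRows, referenceMatrix, referenceRow, reindex, hrow, hsample m m.2]

variable {κ : Measure MInfty} [IsProbabilityMeasure κ]

theorem IsExchangeable.exists_kernel_referenceRow (hκ : IsExchangeable κ) :
    ∃ k : Kernel MInfty (ℕ → unitInterval), ∃ _ : IsMarkovKernel k,
      HasCondDistrib (fun d n => referenceRow n d) referenceMatrix
        (infinitePiKernel fun _ => k) κ := by
  let k := condDistrib (referenceRow 0) referenceMatrix κ
  have hk : HasCondDistrib (referenceRow 0) referenceMatrix k κ :=
    hasCondDistrib_condDistrib measurable_referenceMatrix (measurable_referenceRow 0)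
  have hkn (n : ℕ) : HasCondDistrib (referenceRow n) referenceMatrix k κ := by
    let σ : ℕ → ℕ := Equiv.swap 0 (2 * n)
    have hσ0 : σ 0 = 2 * n := Equiv.swap_apply_left _ _
    have hσ (i : ℕ) : σ (2 * i + 1) = 2 * i + 1 :=
      Equiv.swap_apply_of_ne_of_ne (by omega) (by omega)
    have hσ' (g : ℕ) : σ (4 * g + 1) = 4 * g + 1 :=
      Equiv.swap_apply_of_ne_of_ne (by omega) (by omega)
    have hrow : referenceRow 0 ∘ reindex σ = referenceRow n :=
      funext fun d => funext fun g => by simp [referenceRow, reindex, hσ0, hσ']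
    have hmatrix : referenceMatrix ∘ reindex σ = referenceMatrix :=
      funext fun d => MInfty.ext fun i j => by simp [referenceMatrix, reindex, hσ]
    have h := hasCondDistrib_comp_measurePreserving measurable_referenceMatrix
      (measurable_referenceRow 0) hk (hκ.measurePreserving_reindex (σ := σ) (Equiv.injective _))
    rwa [hrow, hmatrix] at h
  refine ⟨k, inferInstance, hasCondDistrib_infinitePiKernel_comap_of_measurePreserving
    (f := fun _ => id) (q := fun _ => k) (T := fun n => reindex (hideOtherPoints n))
    measurable_referenceMatrix measurable_referenceRow (fun _ => measurable_id) hkn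
    (fun n => hκ.measurePreserving_reindex (hideOtherPoints_injective n)) (fun n d => ?_)
    fun n => ⟨hiddenRows n, ?_, fun d => (hiddenRows_referenceMatrix n d).symm⟩⟩
  · funext g
    simp [referenceRow, reindex, hideOtherPoints]
  · exact (measurable_reindex _).prodMk (measurable_pi_lambda _ fun m =>
      measurable_pi_lambda _ fun g => measurable_entry _ _)

end Rows

section Lengths

/-- Moves the first two sample points to the `m`-th and the `n`-th one and fixes the reference
points of the first kind. All other points become reference points of the second kind. -/
def choosePair (m n l : ℕ) : ℕ :=
  if l = 0 then 2 * m else if l = 2 then 2 * n else if l % 4 = 1 then l else 4 * l + 3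

theorem choosePair_injective {m n : ℕ} (hmn : m ≠ n) : Function.Injective (choosePair m n) := by
  intro i j h
  simp only [choosePair] at h
  split_ifs at h <;> omega

theorem pairProfile_reindex_choosePair (m n : ℕ) (d : MInfty) :
    pairProfile 0 1 (reindex (choosePair m n) d) = pairProfile m n d := by
  have href (g : ℕ) : choosePair m n (4 * g + 1) = 4 * g + 1 := by
    rw [choosePair, if_neg (by omega), if_neg (by omega), if_pos (by omega)]
  refine Prod.ext (MInfty.ext fun i j => ?_)
    (Prod.ext (funext fun g => ?_) (funext fun g => ?_))
  · simp [pairProfile, reindex, href]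
  · simp [pairProfile, referenceRow, reindex, choosePair]
  · simp [pairProfile, referenceRow, reindex, choosePair]

variable {κ : Measure MInfty} [IsProbabilityMeasure κ]

theorem IsExchangeable.exists_symmetric_kernel_length (hκ : IsExchangeable κ) :
    ∃ q : Kernel PairProfile unitInterval, ∃ _ : IsMarkovKernel q,
      (∀ D x y, q (D, y, x) = q (D, x, y)) ∧ ∀ m n, m ≠ n →
        HasCondDistrib (fun d : MInfty => d.1 (2 * m) (2 * n)) (pairProfile m n) q κ := by
  have hprofile := measurable_pairProfile 0 1
  have hlength := measurable_entry 0 2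
  have hswap : κ.map (fun d => (pairProfile 1 0 d, d.1 0 2))
      = κ.map (fun d => (pairProfile 0 1 d, d.1 0 2)) := by
    conv_rhs => rw [← hκ _ (choosePair_injective one_ne_zero),
      Measure.map_map (hprofile.prodMk hlength) (measurable_reindex _)]
    congr 1
    funext d
    exact Prod.ext (pairProfile_reindex_choosePair 1 0 d).symm (d.2.1 0 2)
  obtain ⟨q, hqM, hqs, hq⟩ := exists_symmetric_hasCondDistrib (P := κ) hprofile hlength
    (s := fun v => (v.1, v.2.2, v.2.1)) (by fun_prop) (fun _ => rfl) hswap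
  refine ⟨q, hqM, fun D x y => hqs (D, x, y), fun m n hmn => ?_⟩
  have hprofile_comp : pairProfile 0 1 ∘ reindex (choosePair m n) = pairProfile m n :=
    funext (pairProfile_reindex_choosePair m n)
  have h := hasCondDistrib_comp_measurePreserving hprofile hlength hq
    (hκ.measurePreserving_reindex (choosePair_injective hmn))
  rwa [hprofile_comp] at h

/-- Fixes the `m`-th and the `n`-th sample point and moves all other points to reference points of
the first kind. -/
def hideOthersFromPair (m n l : ℕ) : ℕ := if l = 2 * m ∨ l = 2 * n then l else 4 * l + 1

theorem hideOthersFromPair_injective (m n : ℕ) : Function.Injective (hideOthersFromPair m n) := by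
  intro i j h
  simp only [hideOthersFromPair] at h
  split_ifs at h <;> omega

/-- The distance between the points `i` and `j` after `hideOthersFromPair m n`, as a function of the
profile of the pair. It is meaningful unless both `i` and `j` are among `2 * m` and `2 * n`. -/
def hiddenEntry (m n i j : ℕ) (v : PairProfile) : unitInterval :=
  if i = 2 * m then v.2.1 j else if i = 2 * n then v.2.2 j
  else if j = 2 * m then v.2.1 i else if j = 2 * n then v.2.2 i else v.1.1 i j

theorem measurable_hiddenEntry (m n i j : ℕ) : Measurable (hiddenEntry m n i j) := by
  have hrow (g : ℕ) : Measurable fun v : PairProfile => v.2.1 g := by fun_prop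
  have hrow' (g : ℕ) : Measurable fun v : PairProfile => v.2.2 g := by fun_prop
  have hentry : Measurable fun v : PairProfile => v.1.1 i j :=
    (measurable_entry i j).comp measurable_fst
  exact .ite (.const _) (hrow j) (.ite (.const _) (hrow' j) (.ite (.const _) (hrow i)
    (.ite (.const _) (hrow' i) hentry)))

theorem hiddenEntry_pairProfile {m n i j : ℕ}
    (h : ¬((i = 2 * m ∨ i = 2 * n) ∧ (j = 2 * m ∨ j = 2 * n))) (d : MInfty) :
    hiddenEntry m n i j (pairProfile m n d) = (reindex (hideOthersFromPair m n) d).1 i j := by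
  simp only [hiddenEntry, pairProfile, referenceRow, reindex, hideOthersFromPair]
  split_ifs <;> first | omega | grind [d.2.1]

/-- The reference matrix, the rows and the lengths other than the `p`-th one, after
`hideOthersFromPair`, as a function of the profile of the pair `p`. -/
def hiddenLengths (p : UpperPair) (v : PairProfile) :
    (MInfty × (ℕ → ℕ → unitInterval)) × ({r : UpperPair // r ≠ p} → unitInterval) :=
  ((reindex (fun i => 2 * i + 1) v.1,
    fun l g => hiddenEntry p.1.1 p.1.2 (2 * l) (4 * g + 1) v),
    fun r => hiddenEntry p.1.1 p.1.2 (2 * r.1.1.1) (2 * r.1.1.2) v)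

theorem measurable_hiddenLengths (p : UpperPair) : Measurable (hiddenLengths p) := by
  have hrow (l : ℕ) : Measurable fun v : PairProfile => fun g =>
      hiddenEntry p.1.1 p.1.2 (2 * l) (4 * g + 1) v :=
    measurable_pi_lambda _ fun g => measurable_hiddenEntry _ _ _ _
  exact (((measurable_reindex _).comp measurable_fst).prodMk (measurable_pi_lambda _ hrow)).prodMk
    (measurable_pi_lambda _ fun r => measurable_hiddenEntry _ _ _ _)

theorem hiddenLengths_pairProfile (p : UpperPair) (d : MInfty) :
    let d' := reindex (hideOthersFromPair p.1.1 p.1.2) d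
    hiddenLengths p (pairProfile p.1.1 p.1.2 d)
      = ((referenceMatrix d', fun n => referenceRow n d'),
        fun r : {r : UpperPair // r ≠ p} => d'.1 (2 * r.1.1.1) (2 * r.1.1.2)) := by
  have hodd (i : ℕ) :
      hideOthersFromPair p.1.1 p.1.2 (2 * i + 1) = 4 * (2 * i + 1) + 1 := by
    simp only [hideOthersFromPair]
    split_ifs <;> omega
  refine Prod.ext (Prod.ext (MInfty.ext fun i j => ?_) (funext fun n => funext fun g => ?_))
    (funext fun r => ?_)
  · simp only [hiddenLengths, pairProfile, referenceMatrix, reindex, hodd]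
  · exact hiddenEntry_pairProfile (by omega) d
  · obtain ⟨⟨⟨a, b⟩, hab⟩, hr⟩ := r
    obtain ⟨⟨m, n⟩, hmn⟩ := p
    have hne : a = m → b ≠ n := by
      rintro rfl rfl
      exact hr rfl
    dsimp only at hab hmn
    exact hiddenEntry_pairProfile (by dsimp only; omega) d

theorem hasCondDistrib_upperEntries_sampleMatrix (hκ : IsExchangeable κ)
    {q : Kernel PairProfile unitInterval} [IsMarkovKernel q]
    (hq : ∀ m n, m ≠ n →
      HasCondDistrib (fun d : MInfty => d.1 (2 * m) (2 * n)) (pairProfile m n) q κ) :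
    HasCondDistrib (fun d => upperEntries (sampleMatrix d))
      (fun d => (referenceMatrix d, fun n => referenceRow n d))
      (infinitePiKernel fun p : UpperPair =>
        q.comap (extractProfile p) (measurable_extractProfile p)) κ := by
  have hprofile (p : UpperPair) :
      extractProfile p ∘ (fun d => (referenceMatrix d, fun n => referenceRow n d))
        = pairProfile p.1.1 p.1.2 := funext (extractProfile_referenceMatrix p)
  refine hasCondDistrib_infinitePiKernel_comap_of_measurePreserving (by fun_prop)
    (fun p => measurable_entry _ _) measurable_extractProfile (fun p => ?_)
    (T := fun p => reindex (hideOthersFromPair p.1.1 p.1.2))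
    (fun p => hκ.measurePreserving_reindex (hideOthersFromPair_injective _ _)) (fun p d => ?_)
    fun p => ⟨hiddenLengths p, measurable_hiddenLengths p, fun d => ?_⟩
  · rw [hprofile]
    exact hq _ _ p.2.ne
  · simp [reindex, hideOthersFromPair]
  · rw [extractProfile_referenceMatrix]
    exact (hiddenLengths_pairProfile p d).symm

end Lengths

section QuantumRepresentation

theorem IsRandomSemimetric.hasCondDistrib_const_upperEntries {κ : Measure MInfty}
    [IsProbabilityMeasure κ] (hκ : IsRandomSemimetric κ) :
    HasCondDistrib (fun d => upperEntries (sampleMatrix d)) referenceMatrix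
      (Kernel.const MInfty (κ.map upperEntries)) κ := by
  have hue := measurable_upperEntries
  have hodd : κ.map referenceMatrix = κ := hκ.exchangeable _ fun i j h => by omega
  have hindep : κ.map (fun d => (referenceMatrix d, sampleMatrix d)) = κ.prod κ :=
    hκ.dissociated _ _ (fun i j h => by omega) (fun i j h => by omega) fun i j => by omega
  refine ⟨by fun_prop, ?_⟩
  have := Measure.isProbabilityMeasure_map (μ := κ) hue.aemeasurable
  rw [hodd, Measure.compProd_const]
  calc κ.map (fun d => (referenceMatrix d, upperEntries (sampleMatrix d)))
      = (κ.map fun d => (referenceMatrix d, sampleMatrix d)).map (Prod.map id upperEntries) := by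
        rw [Measure.map_map (by fun_prop) (by fun_prop)]
        rfl
    _ = κ.prod (κ.map upperEntries) := by
        rw [hindep, ← Measure.map_prod_map _ _ measurable_id hue, Measure.map_id]

-- The law of the lengths between sample points given the reference matrix is the law prescribed by
-- `κ`, since the two are independent. So almost every reference matrix has the required property.
theorem IsRandomSemimetric.exists_entryLaw_eq {κ : Measure MInfty} [IsProbabilityMeasure κ]
    (hκ : IsRandomSemimetric κ) :
    ∃ (ν : ProbabilityMeasure (ℕ → unitInterval))
      (q : (ℕ → unitInterval) → (ℕ → unitInterval) → ProbabilityMeasure unitInterval),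
      Measurable (Function.uncurry q) ∧ (∀ x y, q x y = q y x) ∧
      entryLaw (ν : Measure (ℕ → unitInterval)) q = κ.map upperEntries := by
  have hue := measurable_upperEntries
  have := Measure.isProbabilityMeasure_map (μ := κ) hue.aemeasurable
  have := Measure.isProbabilityMeasure_map (μ := κ) measurable_referenceMatrix.aemeasurable
  obtain ⟨k, hkM, hk⟩ := hκ.exchangeable.exists_kernel_referenceRow
  obtain ⟨q, hqM, hqs, hq⟩ := hκ.exchangeable.exists_symmetric_kernel_length
  have hlengths := (hasCondDistrib_prodMk measurable_referenceMatrix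
    (measurable_pi_lambda _ measurable_referenceRow) (hue.comp measurable_sampleMatrix) hk
    (hasCondDistrib_upperEntries_sampleMatrix hκ.exchangeable hq)).snd
  obtain ⟨D, hD⟩ := (Kernel.ae_eq_of_compProd_eq
    (hlengths.map_eq.symm.trans hκ.hasCondDistrib_const_upperEntries.map_eq)).exists
  let B : MInfty := reindex (fun g => 2 * g) D
  refine ⟨⟨k D, inferInstance⟩, fun x y => ⟨q (B, x, y), inferInstance⟩, ?_,
    fun x y => Subtype.ext (hqs B y x), ?_⟩
  · exact (q.measurable.comp (measurable_prodMk_left (x := B))).subtype_mk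
  · rw [snd_compProd_eq_bind, Kernel.const_apply] at hD
    exact hD

/-- The lengths `q` between points with labels, where points with equal labels are at distance
`0`. If the labels are diffuse, this makes the diagonal harmless. -/
noncomputable def withLabels {α : Type*} (q : α → α → ProbabilityMeasure unitInterval)
    (a b : α × ℝ) : ProbabilityMeasure unitInterval :=
  if a.2 = b.2 then diracZero else q a.1 b.1

theorem measurable_withLabels {α : Type*} [MeasurableSpace α]
    {q : α → α → ProbabilityMeasure unitInterval} (hq : Measurable (Function.uncurry q)) :
    Measurable (Function.uncurry (withLabels q)) :=
  .ite (measurableSet_eq_fun (by fun_prop) (by fun_prop)) measurable_const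
    (hq.comp (by fun_prop : Measurable fun p : (α × ℝ) × (α × ℝ) => (p.1.1, p.2.1)))

theorem entryLaw_withLabels {α : Type*} [MeasurableSpace α] (ν : Measure α)
    [IsProbabilityMeasure ν] {q : α → α → ProbabilityMeasure unitInterval}
    (hq : Measurable (Function.uncurry q)) :
    entryLaw (ν.prod labelMeasure) (withLabels q) = entryLaw ν q := by
  have hpoints : (Measure.infinitePi fun _ : ℕ => ν.prod labelMeasure).map (fun z i => (z i).1)
      = Measure.infinitePi fun _ : ℕ => ν := by
    rw [Measure.infinitePi_map_pi _ fun _ => measurable_fst]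
    simp only [Measure.map_fst_prod, measure_univ, one_smul]
  have hlabels : (Measure.infinitePi fun _ : ℕ => ν.prod labelMeasure).map (fun z i => (z i).2)
      = Measure.infinitePi fun _ : ℕ => labelMeasure := by
    rw [Measure.infinitePi_map_pi _ fun _ => measurable_snd]
    simp only [Measure.map_snd_prod, measure_univ, one_smul]
  have hsnd : Measurable fun (z : ℕ → α × ℝ) i => (z i).2 := by fun_prop
  have hinj := ae_injective_infinitePi (ι := ℕ) labelMeasure
  rw [← hlabels] at hinj
  rw [entryLaw, entryLaw, ← hpoints,
    bind_measure_map _ (by fun_prop) (measurable_infinitePi_entries hq)]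
  refine Measure.bind_congr_right ?_
  filter_upwards [ae_of_ae_map hsnd.aemeasurable hinj] with z hz
  have hne (p : UpperPair) : (z p.1.1).2 ≠ (z p.1.2).2 := hz.ne p.2.ne
  simp only [withLabels, hne, if_false]

theorem exists_qmmSpace_tau_eq {α : Type u} [MeasurableSpace α] [StandardBorelSpace α]
    (ν : Measure α) [IsProbabilityMeasure ν] {q : α → α → ProbabilityMeasure unitInterval}
    (hq : Measurable (Function.uncurry q)) (hqs : ∀ x y, q x y = q y x)
    (htri : ∀ᵐ e ∂entryLaw ν q, firstTriangle e ∈ triangleSet) :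
    ∃ X : QMMSpace.{u}, (X.tau : Measure MInfty) = (entryLaw ν q).map symmFill := by
  rw [← entryLaw_withLabels ν hq] at htri ⊢
  let X : QMMSpace.{u} :=
    { carrier := α × ℝ
      μ := ν.prod labelMeasure
      d := withLabels q
      measurable_d := measurable_withLabels hq
      d_self := fun a => if_pos rfl
      d_comm := fun a b => by simp only [withLabels, hqs a.1 b.1, eq_comm (a := a.2)]
      triangle := (ae_entryLaw_firstTriangle_iff (measurable_withLabels hq)
        measurableSet_triangleSet).1 htri }
  exact ⟨X, X.coe_tau_eq_map_entryLaw⟩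

theorem IsRandomSemimetric.exists_qmmSpace {κ : ProbabilityMeasure MInfty}
    (hκ : IsRandomSemimetric (κ : Measure MInfty)) : ∃ X : QMMSpace.{0}, X.tau = κ := by
  obtain ⟨ν, q, hq, hqs, hentries⟩ := hκ.exists_entryLaw_eq
  have hfill : symmFill ∘ upperEntries = id := funext symmFill_upperEntries
  obtain ⟨X, hX⟩ := exists_qmmSpace_tau_eq (ν : Measure (ℕ → unitInterval)) hq hqs (by
    rw [hentries]
    refine (ae_map_iff measurable_upperEntries.aemeasurable
      (measurable_firstTriangle measurableSet_triangleSet)).2 ?_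
    filter_upwards [hκ.ae_isSemimetric] with d hd
    exact firstTriangle_mem_triangleSet (by rwa [symmFill_upperEntries]))
  refine ⟨X, Subtype.ext (hX.trans ?_)⟩
  rw [hentries, Measure.map_map measurable_symmFill measurable_upperEntries, hfill, Measure.map_id]
  rfl

end QuantumRepresentation

theorem mainTheorem1 :
    (∀ κ ∈ chiBar, ∃ X : QMMSpace.{0}, X.tau = κ) ∧
    (∀ X : QMMSpace.{u}, X.tau ∈ chiBar) :=
  ⟨fun _ hκ => (isRandomSemimetric_of_mem_chiBar hκ).exists_qmmSpace,
    fun X => X.isRandomSemimetric_tau.mem_chiBar⟩
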